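/- Let $\Omega=\mathbf P^1(\mathbf F_{23})=\{\infty,0,1,\dots,22\}$, and fix a Steiner system $S(5,8,24)$ on $\Omega$, i.e. a set of $8$-element subsets of $\Omega$ (octads) such that every $5$-element subset of $\Omega$ lies in exactly one octad. For $A\subset\Omega$ put $\nu_A=\sum_{i\in A}e_i\in\mathbf Q^{\Omega}$, where $(e_i)$ is the standard basis, and write $\nu_i=\nu_{\{i\}}$. Let $\Lambda\subset\mathbf Q^\Omega$ be the Leech lattice, i.e. the subgroup generated by $\nu_\Omega-4\nu_\infty$ and all $2\nu_K$ with $K$ an octad, with the form $\langle x,y\rangle=-\frac{x\cdot y}{8}$. Let $\mathrm{II}_{1,25}=U\oplus\Lambda$ be the lattice of vectors $(m,n,\lambda)$, $m,n\in\mathbf Z$, $\lambda\in\Lambda$, with the form $\langle(m,n,\lambda),(m',n',\lambda')\rangle=mn'+m'n+\langle\lambda,\lambda'\rangle$. Let $\rho=(1,0,0)$ be the Weyl vector; a Leech root is a vector $r\in\mathrm{II}_{1,25}$ with $\langle r,r\rangle=-2$ and $\langle r,\rho\rangle=1$. Let $R$ be the sublattice generated by the four Leech roots $$(2,1,4\nu_\infty+\nu_\Omega),\quad(-1,1,0),\quad(1,1,4\nu_\infty+4\nu_0),\quad(1,1,\nu_\Omega-4\nu_1),$$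 let $S=R^\perp$ be the orthogonal complement of $R$ in $\mathrm{II}_{1,25}$, and let $w$ be the orthogonal projection of $\rho$ to $S\otimes\mathbf Q$, i.e. the unique $w\in S\otimes\mathbf Q$ such that $\rho-w$ is orthogonal to $S$. Then $w$ is well defined, there are exactly $112$ Leech roots $r_\alpha$ orthogonal to $R$, and: (1) Each $r_\alpha$ meets exactly $30$ members of $\{r_\alpha\}$: for each $\alpha$ there are exactly $30$ indices $\beta\neq\alpha$ with $\langle r_\alpha,r_\beta\rangle\neq0$; for these $\langle r_\alpha,r_\beta\rangle=1$. (2) The $112$ vectors $r_\alpha$ generate $S$ as an abelian group. (3) $\langle w,r_\alpha\rangle=1$ for every $\alpha$. (4) $w=\frac1{28}\sum_\alpha r_\alpha$. -/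

import Mathlib

/-- The projective line over `𝔽₂₃`, written as `{∞, 0, 1, …, 22}`. -/
abbrev Omega : Type := OnePoint (ZMod 23)

instance instDecidableEqOmega : DecidableEq Omega :=
  inferInstanceAs (DecidableEq (Option (ZMod 23)))

/-- `𝒪` is a Steiner system `S(5,8,24)` on the 24-element set `Omega`: a set of 8-element subsets
("octads") such that every 5-element subset lies in exactly one of them. -/
def IsSteinerSystem (𝒪 : Set (Finset Omega)) : Prop :=
  (∀ K ∈ 𝒪, K.card = 8) ∧ ∀ T : Finset Omega, T.card = 5 → ∃! K, K ∈ 𝒪 ∧ T ⊆ K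

/-- The vector `ν_A = ∑_{i ∈ A} e_i`, i.e. the indicator vector of `A`. -/
def nu (A : Finset Omega) : Omega → ℚ := fun i => if i ∈ A then 1 else 0

/-- The Leech lattice attached to a Steiner system: the subgroup generated by `ν_Ω - 4 ν_∞` and
by the `2 ν_K`, `K` an octad. Its form is `-(x ⬝ y) / 8`. -/
def leechLattice (𝒪 : Set (Finset Omega)) : Submodule ℤ (Omega → ℚ) :=
  Submodule.span ℤ
    ({nu Finset.univ - (4 : ℚ) • nu {OnePoint.infty}} ∪ {v | ∃ K ∈ 𝒪, v = (2 : ℚ) • nu K})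

/-- The rational quadratic space `(U ⊕ Λ) ⊗ ℚ`; its vectors are written `(m, n, l)`. -/
abbrev Ambient : Type := ℚ × ℚ × (Omega → ℚ)

/-- The bilinear form of `(U ⊕ Λ) ⊗ ℚ`, with norm `2mn - (l ⬝ l) / 8`. -/
def form (u v : Ambient) : ℚ :=
  u.1 * v.2.1 + u.2.1 * v.1 - (∑ i, u.2.2 i * v.2.2 i) / 8

/-- The lattice `II_{1,25} = U ⊕ Λ`: vectors `(m, n, l)` with `m, n` integers and `l ∈ Λ`. -/
def latticeII (𝒪 : Set (Finset Omega)) : Submodule ℤ Ambient :=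
  (Submodule.span ℤ {(1 : ℚ)}).prod ((Submodule.span ℤ {(1 : ℚ)}).prod (leechLattice 𝒪))

/-- The Weyl vector `ρ = (1, 0, 0)`. -/
def weylVector : Ambient := (1, 0, 0)

/-- Leech roots: vectors `r` of `II_{1,25}` with `⟨r, r⟩ = -2` and `⟨r, ρ⟩ = 1`. -/
def leechRoots (𝒪 : Set (Finset Omega)) : Set Ambient :=
  {r | r ∈ latticeII 𝒪 ∧ form r r = -2 ∧ form r weylVector = 1}

/-- `x = (2, 1, X)` with `X = 4 ν_∞ + ν_Ω`. -/
def rootX : Ambient := (2, 1, (4 : ℚ) • nu {OnePoint.infty} + nu Finset.univ)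

/-- `z = (-1, 1, 0)`. -/
def rootZ : Ambient := (-1, 1, 0)

/-- `p = (1, 1, P)` with `P = 4 ν_∞ + 4 ν_0`. -/
def rootP : Ambient :=
  (1, 1, (4 : ℚ) • nu {OnePoint.infty} + (4 : ℚ) • nu {((0 : ZMod 23) : Omega)})

/-- `q = (1, 1, Q)` with `Q = ν_Ω - 4 ν_1`. -/
def rootQ : Ambient := (1, 1, nu Finset.univ - (4 : ℚ) • nu {((1 : ZMod 23) : Omega)})

/-- The root lattice `R` generated by `x, z, p, q`. -/
def latticeR : Submodule ℤ Ambient := Submodule.span ℤ {rootX, rootZ, rootP, rootQ}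

theorem form_zero_left (v : Ambient) : form 0 v = 0 := by
  simp [form]

theorem form_add_left (u u' v : Ambient) : form (u + u') v = form u v + form u' v := by
  simp only [form, Prod.fst_add, Prod.snd_add, Pi.add_apply, add_mul, Finset.sum_add_distrib]
  ring

theorem form_zsmul_left (c : ℤ) (u v : Ambient) : form (c • u) v = c * form u v := by
  have h1 : (c • u).1 = c * u.1 := by rw [Prod.smul_fst, zsmul_eq_mul]
  have h2 : (c • u).2.1 = c * u.2.1 := by rw [Prod.smul_snd, Prod.smul_fst, zsmul_eq_mul]
  have h3 : ∀ i, (c • u).2.2 i = c * u.2.2 i := fun i => by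
    rw [Prod.smul_snd, Prod.smul_snd, Pi.smul_apply, zsmul_eq_mul]
  simp only [form, h1, h2, h3, mul_assoc, ← Finset.mul_sum]
  ring

/-- The lattice `S`: the orthogonal complement of `R` in `II_{1,25}`. -/
def latticeS (𝒪 : Set (Finset Omega)) : Submodule ℤ Ambient where
  carrier := {v | v ∈ latticeII 𝒪 ∧ ∀ r ∈ latticeR, form v r = 0}
  zero_mem' := ⟨zero_mem _, fun r _ => form_zero_left r⟩
  add_mem' := fun {a b} ha hb => ⟨add_mem ha.1 hb.1, fun r hr => by
    rw [form_add_left, ha.2 r hr, hb.2 r hr, add_zero]⟩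
  smul_mem' := fun c v hv => ⟨Submodule.smul_mem _ c hv.1, fun r hr => by
    rw [form_zsmul_left, hv.2 r hr, mul_zero]⟩

/-- The Leech roots orthogonal to `R`. -/
def leechRootsPerp (𝒪 : Set (Finset Omega)) : Set Ambient :=
  {r | r ∈ leechRoots 𝒪 ∧ ∀ s ∈ latticeR, form r s = 0}

/-- `w` is an orthogonal projection of `v` to `L ⊗ ℚ`: it lies in the rational span of `L`, and
`v - w` is orthogonal to `L`. -/
def IsOrthogonalProjection (L : Submodule ℤ Ambient) (v w : Ambient) : Prop :=
  w ∈ Submodule.span ℚ (L : Set Ambient) ∧ ∀ s ∈ L, form (v - w) s = 0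

/-!
The proof works with an arbitrary Steiner system, without using that it is unique.

Counting incidences gives the numbers 253, 77, 21, 5, 1 of octads through one to five points
(`IsSteinerSystem.card_octadsThrough`), and from these that two octads meet in an even number of
points (`even_card_inter`). A set meeting all octads evenly cannot have four points, and is an octad
if it has eight (`card_ne_four`, `mem_of_isEvenSet`). This is all that is needed of the Golay code.

A Leech root orthogonal to `R` has the form `(1, 1, l)` with `l` a vector of norm 32 in `Λ` whose
coordinates satisfy `l_∞ + l_0 = 4`, `l_∞ + l_1 = 2` and `∑ l_i + 4 l_∞ = 24`. The norm leaves few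
possibilities for `l_∞`, and the facts on even sets reduce them to `l = 2 ν_K` with `∞, 0 ∈ K`,
`1 ∉ K`, and `l = ν_Ω - 2 ν_K + 4 ν_∞` with `∞, 1 ∈ K`, `0 ∉ K`, for octads `K`
(`eq_evenRoot_or_oddRoot`). Each kind has `77 - 21 = 56` members.

The projection of `ρ` is `w = ρ + x + z + p + q`, where `x, z, p, q` are the given generators of
`R`: it is orthogonal to `R`, and summing the roots coordinate by coordinate gives `28 w`
(`sum_perpRoots_eq`). So `w` pairs to `⟨ρ, r⟩ = 1` with each root `r`, and as distinct roots have
product 0 or 1, the identity `28 = 28 ⟨w, r⟩ = -2 + N` yields the number `N = 30` of roots meeting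
`r`. Uniqueness of `w` is nondegeneracy of `S ⊗ ℚ`, which follows from `⟨w, w⟩ = 4 > 0` and the
Cauchy–Schwarz inequality (`eq_zero_of_form_eq_zero`).

For the generation of `S` (`span_leechRootsPerp`), subtracting multiples of two roots reduces to
vectors `(0, 0, 2 y)` with `y` supported off `∞, 0, 1`. Four suitable roots combine to
`4 (ν_i - ν_j)` (`two_single_sub_single_mem`), so that only `y` modulo 2 matters. There, duality over
`𝔽₂` applies: a functional vanishing on the differences of roots is summation over a set, which
may be changed by octads until it has at most four points, and then moment identities for its
intersections with the 56 octads through `∞` and `0` avoiding `1` show that it lies in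
`{∞, 0, 1}` (`eq_empty_of_parity_eq`, `even_sum_of_parity_eq`).
-/

/-! ### Octads through a given set -/

theorem card_omega : Fintype.card Omega = 24 := by
  show Fintype.card (Option (ZMod 23)) = 24
  simp [ZMod.card]

open Classical in
/-- The finite set of octads containing `T`. -/
noncomputable def octadsThrough (𝒪 : Set (Finset Omega)) (T : Finset Omega) :
    Finset (Finset Omega) :=
  Finset.univ.filter fun K => K ∈ 𝒪 ∧ T ⊆ K

/-- The number of octads containing `t` given points, for `1 ≤ t ≤ 5`. -/
def octadCount : ℕ → ℕ
  | 1 => 253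
  | 2 => 77
  | 3 => 21
  | 4 => 5
  | 5 => 1
  | _ => 0

@[simp]
theorem mem_octadsThrough {𝒪 : Set (Finset Omega)} {T K : Finset Omega} :
    K ∈ octadsThrough 𝒪 T ↔ K ∈ 𝒪 ∧ T ⊆ K := by
  classical
  simp [octadsThrough]

theorem octadsThrough_insert (𝒪 : Set (Finset Omega)) (T : Finset Omega) (i : Omega) :
    octadsThrough 𝒪 (insert i T) = (octadsThrough 𝒪 T).filter (i ∈ ·) := by
  ext K
  simp only [mem_octadsThrough, Finset.mem_filter, Finset.insert_subset_iff]
  tauto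

/-- Double counting of the pairs `(K, i)` with `T ⊆ K` and `i ∈ K ∩ U`, weighted by a function
of both. -/
theorem sum_octadsThrough_sum_inter {M : Type*} [AddCommMonoid M] (𝒪 : Set (Finset Omega))
    (T U : Finset Omega) (f : Finset Omega → Omega → M) :
    ∑ K ∈ octadsThrough 𝒪 T, ∑ i ∈ K ∩ U, f K i =
      ∑ i ∈ U, ∑ K ∈ octadsThrough 𝒪 (insert i T), f K i := by
  have h1 : ∀ K : Finset Omega, ∑ i ∈ K ∩ U, f K i = ∑ i ∈ U, if i ∈ K then f K i else 0 := by
    intro K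
    rw [← Finset.sum_filter, Finset.filter_mem_eq_inter, Finset.inter_comm]
  simp only [h1, octadsThrough_insert, Finset.sum_filter]
  exact Finset.sum_comm

theorem sum_card_inter (𝒪 : Set (Finset Omega)) (T U : Finset Omega) :
    ∑ K ∈ octadsThrough 𝒪 T, (K ∩ U).card = ∑ i ∈ U, (octadsThrough 𝒪 (insert i T)).card := by
  simpa using sum_octadsThrough_sum_inter 𝒪 T U fun _ _ => (1 : ℕ)

section Steiner

variable {𝒪 : Set (Finset Omega)}

theorem IsSteinerSystem.eq_of_five_le (h : IsSteinerSystem 𝒪) {K K' : Finset Omega}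
    (hK : K ∈ 𝒪) (hK' : K' ∈ 𝒪) (h5 : 5 ≤ (K ∩ K').card) : K = K' := by
  obtain ⟨T, hT, hT5⟩ := Finset.exists_subset_card_eq h5
  exact (h.2 T hT5).unique ⟨hK, hT.trans Finset.inter_subset_left⟩
    ⟨hK', hT.trans Finset.inter_subset_right⟩

theorem IsSteinerSystem.card_inter_le_four (h : IsSteinerSystem 𝒪) {K K' : Finset Omega}
    (hK : K ∈ 𝒪) (hK' : K' ∈ 𝒪) (hne : K ≠ K') : (K ∩ K').card ≤ 4 := by
  by_contra! h5
  exact hne (h.eq_of_five_le hK hK' h5)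

theorem IsSteinerSystem.card_octadsThrough_five (h : IsSteinerSystem 𝒪) {T : Finset Omega}
    (hT : T.card = 5) : (octadsThrough 𝒪 T).card = 1 := by
  obtain ⟨K, hK, hu⟩ := h.2 T hT
  rw [Finset.card_eq_one]
  refine ⟨K, Finset.ext fun K' => ?_⟩
  rw [mem_octadsThrough, Finset.mem_singleton]
  exact ⟨fun h' => hu K' h', fun h' => h' ▸ hK⟩

/-- If every set of `t + 1` points lies in `c` octads, then double counting the incidences between
octads through a `t`-set and further points relates `c` to the number of these octads. -/
theorem IsSteinerSystem.card_octadsThrough_step (h : IsSteinerSystem 𝒪) {t c : ℕ}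
    (hc : ∀ T : Finset Omega, T.card = t + 1 → (octadsThrough 𝒪 T).card = c)
    {T : Finset Omega} (hT : T.card = t) :
    (24 - t) * c = (8 - t) * (octadsThrough 𝒪 T).card := by
  have h1 := sum_card_inter 𝒪 T Tᶜ
  rw [Finset.sum_congr rfl fun i hi => hc (insert i T)
      (by rw [Finset.card_insert_of_notMem (Finset.mem_compl.1 hi), hT]),
    Finset.sum_const, Finset.card_compl, card_omega, hT, smul_eq_mul] at h1
  rw [← h1, Finset.sum_congr rfl fun K hK => ?_, Finset.sum_const, smul_eq_mul, mul_comm]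
  · rw [mem_octadsThrough] at hK
    rw [← Finset.sdiff_eq_inter_compl, Finset.card_sdiff_of_subset hK.2, h.1 K hK.1, hT]

theorem IsSteinerSystem.card_octadsThrough (h : IsSteinerSystem 𝒪) {T : Finset Omega} {t : ℕ}
    (hT : T.card = t) (h1 : 1 ≤ t) (h5 : t ≤ 5) : (octadsThrough 𝒪 T).card = octadCount t := by
  have e5 : ∀ T : Finset Omega, T.card = 4 + 1 → (octadsThrough 𝒪 T).card = 1 :=
    fun T hT => h.card_octadsThrough_five hT
  have e4 : ∀ T : Finset Omega, T.card = 3 + 1 → (octadsThrough 𝒪 T).card = 5 :=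
    fun T hT => by have := h.card_octadsThrough_step e5 hT; omega
  have e3 : ∀ T : Finset Omega, T.card = 2 + 1 → (octadsThrough 𝒪 T).card = 21 :=
    fun T hT => by have := h.card_octadsThrough_step e4 hT; omega
  have e2 : ∀ T : Finset Omega, T.card = 1 + 1 → (octadsThrough 𝒪 T).card = 77 :=
    fun T hT => by have := h.card_octadsThrough_step e3 hT; omega
  have e1 : ∀ T : Finset Omega, T.card = 1 → (octadsThrough 𝒪 T).card = 253 :=
    fun T hT => by have := h.card_octadsThrough_step e2 hT; omega
  interval_cases t
  exacts [e1 T hT, e2 T hT, e3 T hT, e4 T hT, e5 T hT]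

theorem IsSteinerSystem.sum_card_inter (h : IsSteinerSystem 𝒪) {T U : Finset Omega} {t : ℕ}
    (hT : T.card = t) (h4 : t ≤ 4) (hTU : Disjoint T U) :
    ∑ K ∈ octadsThrough 𝒪 T, (K ∩ U).card = U.card * octadCount (t + 1) := by
  rw [_root_.sum_card_inter, ← smul_eq_mul, ← Finset.sum_const]
  refine Finset.sum_congr rfl fun i hi => h.card_octadsThrough ?_ (by omega) (by omega)
  rw [Finset.card_insert_of_notMem (Finset.disjoint_right.1 hTU hi), hT]

theorem IsSteinerSystem.sum_card_inter_mul_pred (h : IsSteinerSystem 𝒪) {T U : Finset Omega}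
    {t : ℕ} (hT : T.card = t) (h3 : t ≤ 3) (hTU : Disjoint T U) :
    ∑ K ∈ octadsThrough 𝒪 T, (K ∩ U).card * ((K ∩ U).card - 1) =
      U.card * (U.card - 1) * octadCount (t + 2) := by
  have h1 : ∀ K : Finset Omega, (K ∩ U).card * ((K ∩ U).card - 1) =
      ∑ i ∈ K ∩ U, (K ∩ U.erase i).card := by
    intro K
    rw [← smul_eq_mul, ← Finset.sum_const]
    refine Finset.sum_congr rfl fun i hi => ?_
    rw [← Finset.card_erase_of_mem hi, Finset.inter_erase]
  simp only [h1]
  rw [sum_octadsThrough_sum_inter 𝒪 T U fun K i => (K ∩ U.erase i).card, mul_assoc,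
    ← smul_eq_mul, ← Finset.sum_const]
  refine Finset.sum_congr rfl fun i hi => ?_
  rw [h.sum_card_inter (t := t + 1)
    (by rw [Finset.card_insert_of_notMem (Finset.disjoint_right.1 hTU hi), hT]) (by omega),
    Finset.card_erase_of_mem hi]
  rw [Finset.disjoint_insert_left]
  exact ⟨Finset.notMem_erase i U, hTU.mono_right (Finset.erase_subset i U)⟩

/-! ### Two octads meet in an even number of points -/

/-- The 21 octads through a 3-subset `T` of an octad `K` have 25 incidences with the five
points of `K \ T`, five of them with `K` itself; every other octad has at most one, so none of
them has none. -/
theorem IsSteinerSystem.card_inter_ne_three (h : IsSteinerSystem 𝒪) {K K' : Finset Omega}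
    (hK : K ∈ 𝒪) (hK' : K' ∈ 𝒪) : (K ∩ K').card ≠ 3 := by
  intro h3
  set T := K ∩ K' with hT
  have hTK : T ⊆ K := Finset.inter_subset_left
  have hTK' : T ⊆ K' := Finset.inter_subset_right
  have hne : K' ≠ K := by
    rintro rfl
    rw [hT, Finset.inter_self, h.1 K' hK] at h3
    omega
  have hsum := h.sum_card_inter h3 (by omega) (Finset.disjoint_sdiff (s := T) (t := K))
  have hcard := h.card_octadsThrough h3 (by omega) (by omega)
  have hU : (K \ T).card = 5 := by rw [Finset.card_sdiff_of_subset hTK, h.1 K hK, h3]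
  have hm : K ∈ octadsThrough 𝒪 T := mem_octadsThrough.2 ⟨hK, hTK⟩
  have hm' : K' ∈ (octadsThrough 𝒪 T).erase K :=
    Finset.mem_erase.2 ⟨hne, mem_octadsThrough.2 ⟨hK', hTK'⟩⟩
  rw [← Finset.add_sum_erase _ _ hm, ← Finset.add_sum_erase _ _ hm',
    Finset.inter_eq_right.2 Finset.sdiff_subset, hU] at hsum
  have h0 : K' ∩ (K \ T) = ∅ := by
    ext i
    simp only [hT, Finset.mem_inter, Finset.mem_sdiff, Finset.notMem_empty]
    tauto
  have hle : ∑ L ∈ ((octadsThrough 𝒪 T).erase K).erase K', (L ∩ (K \ T)).card ≤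
      ∑ L ∈ ((octadsThrough 𝒪 T).erase K).erase K', 1 := by
    refine Finset.sum_le_sum fun L hL => ?_
    simp only [Finset.mem_erase, mem_octadsThrough] at hL
    have h4 := h.card_inter_le_four hL.2.2.1 hK hL.2.1
    have h5 : T.card + (L ∩ (K \ T)).card = (L ∩ K).card := by
      rw [← Finset.card_union_of_disjoint (Finset.disjoint_sdiff.mono_right
        Finset.inter_subset_right)]
      congr 1
      ext i
      have a1 := @hTK i
      have a2 := @hL.2.2.2 i
      simp only [Finset.mem_union, Finset.mem_inter, Finset.mem_sdiff]
      tauto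
    omega
  rw [Finset.sum_const, Finset.card_erase_of_mem hm', Finset.card_erase_of_mem hm, hcard] at hle
  rw [h0] at hsum
  simp only [octadCount, Finset.card_empty, smul_eq_mul] at hle hsum
  omega

/-- Let `p` be a point of an octad `K`. Summed over the 253 octads `L` through `p`, the quantity
`(k - 2) * (k - 4)` with `k = |K ∩ L|` is 24, which is the contribution of `L = K`. As `k = 3`
does not occur, all other contributions are nonnegative, hence zero, and so `k = 1` does not
occur either. -/
theorem IsSteinerSystem.card_inter_ne_one (h : IsSteinerSystem 𝒪) {K K' : Finset Omega}
    (hK : K ∈ 𝒪) (hK' : K' ∈ 𝒪) : (K ∩ K').card ≠ 1 := by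
  intro h1
  set T := K ∩ K' with hT
  have hTK : T ⊆ K := Finset.inter_subset_left
  have hTK' : T ⊆ K' := Finset.inter_subset_right
  have hne : K ≠ K' := by
    rintro rfl
    rw [hT, Finset.inter_self, h.1 K hK] at h1
    omega
  have hd := Finset.disjoint_sdiff (s := T) (t := K)
  have hs0 := h.card_octadsThrough h1 (by omega) (by omega)
  have hs1 := h.sum_card_inter h1 (by omega) hd
  have hs2 := h.sum_card_inter_mul_pred h1 (by omega) hd
  have hU : (K \ T).card = 7 := by rw [Finset.card_sdiff_of_subset hTK, h.1 K hK, h1]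
  rw [hU] at hs1 hs2
  simp only [octadCount] at hs0 hs1 hs2
  have hcast : ∀ k : ℕ, ((k * (k - 1) : ℕ) : ℤ) = (k : ℤ) * (k - 1) := by
    rintro (_ | k) <;> simp
  have hs1' := congrArg (Nat.cast : ℕ → ℤ) hs1
  have hs2' := congrArg (Nat.cast : ℕ → ℤ) hs2
  rw [Nat.cast_sum] at hs1' hs2'
  simp only [hcast] at hs2'
  have hsum : ∑ L ∈ octadsThrough 𝒪 T,
      (((L ∩ (K \ T)).card : ℤ) - 1) * (((L ∩ (K \ T)).card : ℤ) - 3) = 24 := by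
    have : ∀ L : Finset Omega, (((L ∩ (K \ T)).card : ℤ) - 1) * (((L ∩ (K \ T)).card : ℤ) - 3) =
        ((L ∩ (K \ T)).card : ℤ) * ((L ∩ (K \ T)).card - 1) - 3 * (L ∩ (K \ T)).card + 3 :=
      fun L => by ring
    simp only [this, Finset.sum_add_distrib, Finset.sum_sub_distrib, ← Finset.mul_sum,
      Finset.sum_const, hs1', hs2', hs0]
    norm_num
  have hm : K ∈ octadsThrough 𝒪 T := mem_octadsThrough.2 ⟨hK, hTK⟩
  have hm' : K' ∈ octadsThrough 𝒪 T := mem_octadsThrough.2 ⟨hK', hTK'⟩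
  have hle := Finset.sum_le_sum_of_subset_of_nonneg (s := {K, K'}) (t := octadsThrough 𝒪 T)
    (f := fun L => (((L ∩ (K \ T)).card : ℤ) - 1) * (((L ∩ (K \ T)).card : ℤ) - 3))
    (by simp only [Finset.insert_subset_iff, Finset.singleton_subset_iff, hm, hm', and_self])
    (fun L hL _ => by
      rw [mem_octadsThrough] at hL
      have h3 := h.card_inter_ne_three hL.1 hK
      have h5 : T.card + (L ∩ (K \ T)).card = (L ∩ K).card := by
        rw [← Finset.card_union_of_disjoint (hd.mono_right Finset.inter_subset_right)]
        congr 1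
        ext i
        have a1 := @hTK i
        have a2 := @hL.2 i
        simp only [Finset.mem_union, Finset.mem_inter, Finset.mem_sdiff]
        tauto
      generalize (L ∩ (K \ T)).card = k at h5
      rcases k with _ | _ | _ | k
      · norm_num
      · norm_num
      · omega
      · push_cast
        nlinarith)
  have h0 : K' ∩ (K \ T) = ∅ := by
    ext i
    simp only [hT, Finset.mem_inter, Finset.mem_sdiff, Finset.notMem_empty]
    tauto
  rw [hsum, Finset.sum_pair hne, h0, Finset.inter_eq_right.2 Finset.sdiff_subset, hU] at hle
  norm_num at hle

theorem IsSteinerSystem.even_card_inter (h : IsSteinerSystem 𝒪) {K K' : Finset Omega}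
    (hK : K ∈ 𝒪) (hK' : K' ∈ 𝒪) : Even (K ∩ K').card := by
  by_cases hne : K = K'
  · subst hne
    rw [Finset.inter_self, h.1 K hK]
    decide
  · have h1 := h.card_inter_ne_one hK hK'
    have h3 := h.card_inter_ne_three hK hK'
    have h4 := h.card_inter_le_four hK hK' hne
    interval_cases (K ∩ K').card <;> first | decide | omega

/-! ### Sets meeting every octad evenly -/

/-- `Y` meets every octad in an even number of points, i.e. its indicator vector lies in the dual
of the binary code generated by the octads. -/
def IsEvenSet (𝒪 : Set (Finset Omega)) (Y : Finset Omega) : Prop :=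
  ∀ K ∈ 𝒪, Even (Y ∩ K).card

theorem card_symmDiff_inter (A B K : Finset Omega) :
    (symmDiff A B ∩ K).card + 2 * (A ∩ B ∩ K).card = (A ∩ K).card + (B ∩ K).card := by
  have h1 : (symmDiff A B ∩ K).card = ((A \ B) ∩ K).card + ((B \ A) ∩ K).card := by
    rw [← Finset.card_union_of_disjoint]
    · congr 1
      ext i
      simp only [Finset.mem_symmDiff, Finset.mem_union, Finset.mem_inter, Finset.mem_sdiff]
      tauto
    · rw [Finset.disjoint_left]
      intro i
      simp only [Finset.mem_inter, Finset.mem_sdiff]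
      tauto
  have h2 : ∀ A B : Finset Omega, (A ∩ K).card = ((A \ B) ∩ K).card + (A ∩ B ∩ K).card := by
    intro A B
    rw [← Finset.card_union_of_disjoint]
    · congr 1
      ext i
      simp only [Finset.mem_union, Finset.mem_inter, Finset.mem_sdiff]
      tauto
    · rw [Finset.disjoint_left]
      intro i
      simp only [Finset.mem_inter, Finset.mem_sdiff]
      tauto
  have h3 := h2 A B
  have h4 := h2 B A
  rw [Finset.inter_comm B A] at h4
  omega

theorem card_symmDiff_add (A B : Finset Omega) :
    (symmDiff A B).card + 2 * (A ∩ B).card = A.card + B.card := by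
  simpa using card_symmDiff_inter A B Finset.univ

theorem IsEvenSet.symmDiff {A B : Finset Omega} (hA : IsEvenSet 𝒪 A) (hB : IsEvenSet 𝒪 B) :
    IsEvenSet 𝒪 (symmDiff A B) := fun K hK => by
  have h1 := card_symmDiff_inter A B K
  have h2 := (hA K hK).add (hB K hK)
  rw [← h1, Nat.even_add] at h2
  exact h2.2 (even_two_mul _)

theorem IsSteinerSystem.isEvenSet (h : IsSteinerSystem 𝒪) {K : Finset Omega} (hK : K ∈ 𝒪) :
    IsEvenSet 𝒪 K := fun _ hK' => h.even_card_inter hK hK'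

theorem IsSteinerSystem.card_ne_four (h : IsSteinerSystem 𝒪) {Y : Finset Omega}
    (hY : IsEvenSet 𝒪 Y) : Y.card ≠ 4 := by
  intro h4
  obtain ⟨d, T, hd, rfl, hT⟩ := Finset.card_eq_succ.1 h4
  have h1 := h.card_octadsThrough h4 (by omega) (by omega)
  have h2 := h.card_octadsThrough hT (by omega) (by omega)
  -- 21 octads contain `T` and only 5 of them contain `d`
  obtain ⟨K, hK, hdK⟩ : ∃ K ∈ octadsThrough 𝒪 T, d ∉ K := by
    by_contra! hall
    rw [octadsThrough_insert, Finset.filter_true_of_mem hall, h2] at h1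
    simp [octadCount] at h1
  rw [mem_octadsThrough] at hK
  have h3 := hY K hK.1
  rw [Finset.insert_inter_of_notMem hdK, Finset.inter_eq_left.2 hK.2, hT] at h3
  exact absurd h3 (by decide)

theorem IsSteinerSystem.mem_of_isEvenSet (h : IsSteinerSystem 𝒪) {Y : Finset Omega}
    (hY : IsEvenSet 𝒪 Y) (h8 : Y.card = 8) : Y ∈ 𝒪 := by
  obtain ⟨T, hTY, hT⟩ := Finset.exists_subset_card_eq (show 5 ≤ Y.card by omega)
  obtain ⟨K, ⟨hK, hTK⟩, -⟩ := h.2 T hT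
  have h5 : 5 ≤ (Y ∩ K).card := hT ▸ Finset.card_le_card (Finset.subset_inter hTY hTK)
  have hle : (Y ∩ K).card ≤ 8 := h8 ▸ Finset.card_le_card Finset.inter_subset_left
  have hK8 := h.1 K hK
  have h6 := card_symmDiff_add Y K
  have h7 := h.card_ne_four (hY.symmDiff (h.isEvenSet hK))
  obtain ⟨m, hm⟩ := hY K hK
  have h9 : (Y ∩ K).card = 8 := by omega
  have e1 := Finset.eq_of_subset_of_card_le (Finset.inter_subset_left (s₁ := Y) (s₂ := K))
    (by omega)
  have e2 := Finset.eq_of_subset_of_card_le (Finset.inter_subset_right (s₁ := Y) (s₂ := K))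
    (by omega)
  rw [← e1, e2]
  exact hK

theorem IsSteinerSystem.symmDiff_mem (h : IsSteinerSystem 𝒪) {K K' : Finset Omega}
    (hK : K ∈ 𝒪) (hK' : K' ∈ 𝒪) (h4 : (K ∩ K').card = 4) : symmDiff K K' ∈ 𝒪 := by
  refine h.mem_of_isEvenSet ((h.isEvenSet hK).symmDiff (h.isEvenSet hK')) ?_
  have := card_symmDiff_add K K'
  have := h.1 K hK
  have := h.1 K' hK'
  omega

theorem IsSteinerSystem.exists_three_disjoint (h : IsSteinerSystem 𝒪) :
    ∃ A ∈ 𝒪, ∃ B ∈ 𝒪, ∃ C ∈ 𝒪, Disjoint A B ∧ C = (A ∪ B)ᶜ := by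
  obtain ⟨T, -, hT⟩ := Finset.exists_subset_card_eq
    (show 4 ≤ (Finset.univ : Finset Omega).card by rw [Finset.card_univ, card_omega]; omega)
  have h1 := h.card_octadsThrough hT (by omega) (by omega)
  obtain ⟨P, hP, hP3⟩ := Finset.exists_subset_card_eq
    (show 3 ≤ (octadsThrough 𝒪 T).card by rw [h1]; decide)
  obtain ⟨A, B, C, hAB, hAC, hBC, rfl⟩ := Finset.card_eq_three.1 hP3
  simp only [Finset.insert_subset_iff, Finset.singleton_subset_iff, mem_octadsThrough] at hP
  obtain ⟨⟨hA, hTA⟩, ⟨hB, hTB⟩, ⟨hC, hTC⟩⟩ := hP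
  have key : ∀ {K K' : Finset Omega}, K ∈ 𝒪 → K' ∈ 𝒪 → K ≠ K' → T ⊆ K → T ⊆ K' →
      K ∩ K' = T := fun hK hK' hne hTK hTK' =>
    (Finset.eq_of_subset_of_card_le (Finset.subset_inter hTK hTK')
      (by rw [hT]; exact h.card_inter_le_four hK hK' hne)).symm
  have eAB := key hA hB hAB hTA hTB
  have eAC := key hA hC hAC hTA hTC
  have eBC := key hB hC hBC hTB hTC
  have hD : symmDiff B C ∈ 𝒪 := h.symmDiff_mem hB hC (by rw [eBC, hT])
  have hdis : Disjoint A (symmDiff B C) := by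
    rw [Finset.disjoint_left]
    intro i hi hi'
    have a1 := Finset.ext_iff.1 eAB i
    have a2 := Finset.ext_iff.1 eAC i
    have a3 := @hTB i
    have a4 := @hTC i
    simp only [Finset.mem_symmDiff, Finset.mem_inter] at hi' a1 a2
    tauto
  refine ⟨A, hA, _, hD, _, h.mem_of_isEvenSet ?_ ?_, hdis, rfl⟩
  · intro K hK
    have e : ((A ∪ symmDiff B C)ᶜ ∩ K).card + ((A ∩ K).card + (symmDiff B C ∩ K).card) =
        K.card := by
      rw [← Finset.card_union_of_disjoint (hdis.mono Finset.inter_subset_left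
        Finset.inter_subset_left), ← Finset.union_inter_distrib_right, Finset.inter_comm,
        Finset.inter_comm (A ∪ symmDiff B C), ← Finset.sdiff_eq_inter_compl,
        Finset.card_sdiff_add_card_inter]
    have h2 := (h.isEvenSet hA K hK).add (h.isEvenSet hD K hK)
    have h3 : Even K.card := by rw [h.1 K hK]; decide
    rw [← e, Nat.even_add] at h3
    exact h3.2 h2
  · rw [Finset.card_compl, Finset.card_union_of_disjoint hdis, h.1 A hA, h.1 _ hD, card_omega]

/-! ### Octads through two points that avoid a third -/

/-- The octads containing `a` and `b` but not `c`. -/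
noncomputable def octadsAvoiding (𝒪 : Set (Finset Omega)) (a b c : Omega) :
    Finset (Finset Omega) :=
  (octadsThrough 𝒪 {a, b}).filter (c ∉ ·)

@[simp]
theorem mem_octadsAvoiding {a b c : Omega} {K : Finset Omega} :
    K ∈ octadsAvoiding 𝒪 a b c ↔ K ∈ 𝒪 ∧ a ∈ K ∧ b ∈ K ∧ c ∉ K := by
  simp [octadsAvoiding, Finset.insert_subset_iff, and_assoc]

theorem sum_octadsAvoiding_add {M : Type*} [AddCommMonoid M] (a b c : Omega)
    (f : Finset Omega → M) :
    ∑ K ∈ octadsAvoiding 𝒪 a b c, f K + ∑ K ∈ octadsThrough 𝒪 {c, a, b}, f K =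
      ∑ K ∈ octadsThrough 𝒪 {a, b}, f K := by
  rw [octadsThrough_insert, octadsAvoiding, add_comm]
  exact Finset.sum_filter_add_sum_filter_not _ _ _

section Avoiding

variable {a b c : Omega} (h : IsSteinerSystem 𝒪) (hab : a ≠ b) (hac : a ≠ c) (hbc : b ≠ c)
include h hab hac hbc

theorem IsSteinerSystem.card_octadsAvoiding : (octadsAvoiding 𝒪 a b c).card = 56 := by
  have h1 := sum_octadsAvoiding_add (𝒪 := 𝒪) a b c fun _ => 1
  simp only [Finset.sum_const, smul_eq_mul, mul_one] at h1
  rw [h.card_octadsThrough (Finset.card_pair hab) (by omega) (by omega),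
    h.card_octadsThrough (t := 3) (Finset.card_eq_three.2 ⟨c, a, b, hac.symm, hbc.symm, hab, rfl⟩)
      (by omega) (by omega)] at h1
  simp only [octadCount] at h1
  omega

theorem IsSteinerSystem.sum_card_inter_avoiding {U : Finset Omega}
    (hU : Disjoint {c, a, b} U) :
    ∑ K ∈ octadsAvoiding 𝒪 a b c, (K ∩ U).card = 16 * U.card := by
  have h1 := sum_octadsAvoiding_add (𝒪 := 𝒪) a b c fun K => (K ∩ U).card
  rw [h.sum_card_inter (Finset.card_pair hab) (by omega)
      (hU.mono_left (Finset.subset_insert _ _)),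
    h.sum_card_inter (t := 3) (Finset.card_eq_three.2 ⟨c, a, b, hac.symm, hbc.symm, hab, rfl⟩)
      (by omega) hU] at h1
  simp only [octadCount] at h1
  omega

theorem IsSteinerSystem.sum_card_inter_mul_pred_avoiding {U : Finset Omega}
    (hU : Disjoint {c, a, b} U) :
    ∑ K ∈ octadsAvoiding 𝒪 a b c, (K ∩ U).card * ((K ∩ U).card - 1) =
      4 * (U.card * (U.card - 1)) := by
  have h1 := sum_octadsAvoiding_add (𝒪 := 𝒪) a b c
    fun K => (K ∩ U).card * ((K ∩ U).card - 1)
  rw [h.sum_card_inter_mul_pred (Finset.card_pair hab) (by omega)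
      (hU.mono_left (Finset.subset_insert _ _)),
    h.sum_card_inter_mul_pred (t := 3)
      (Finset.card_eq_three.2 ⟨c, a, b, hac.symm, hbc.symm, hab, rfl⟩) (by omega) hU] at h1
  simp only [octadCount] at h1
  omega

/-- A set of one to four points off `{a, b, c}` meets some octads through `a`, `b` avoiding `c`
evenly and some oddly. With `s` the size of the set and `k` that of its intersection with an
octad, the sum of `k * (k - 2)` over these octads is `4 * s * (s - 5) < 0` and that of
`(k - 1) * (k - 3)` is `4 * (s - 6) * (s - 7) > 0`; the first is impossible if all `k` are even,
the second if all `k ≤ 4` are odd. -/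
theorem IsSteinerSystem.eq_empty_of_parity_eq {U : Finset Omega} (hU : Disjoint {c, a, b} U)
    (h4 : U.card ≤ 4)
    (hpar : ∀ K ∈ octadsAvoiding 𝒪 a b c, ∀ K' ∈ octadsAvoiding 𝒪 a b c,
      (Even (K ∩ U).card ↔ Even (K' ∩ U).card)) : U = ∅ := by
  rw [← Finset.card_eq_zero]
  by_contra h0
  have hs0 := h.card_octadsAvoiding hab hac hbc
  have hs1 := congrArg (Nat.cast : ℕ → ℤ) (h.sum_card_inter_avoiding hab hac hbc hU)
  have hs2 := congrArg (Nat.cast : ℕ → ℤ) (h.sum_card_inter_mul_pred_avoiding hab hac hbc hU)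
  have hcast : ∀ k : ℕ, ((k * (k - 1) : ℕ) : ℤ) = (k : ℤ) * (k - 1) := by
    rintro (_ | k) <;> simp
  rw [Nat.cast_sum] at hs1 hs2
  rw [Nat.cast_mul 4, hcast] at hs2
  simp only [hcast] at hs2
  push_cast at hs1 hs2
  obtain ⟨K₀, hK₀⟩ : (octadsAvoiding 𝒪 a b c).Nonempty := by
    rw [← Finset.card_pos, hs0]; omega
  by_cases hev : Even (K₀ ∩ U).card
  · have hsum : ∑ K ∈ octadsAvoiding 𝒪 a b c,
        ((K ∩ U).card : ℤ) * ((K ∩ U).card - 2) = 4 * (U.card * (U.card - 5)) := by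
      have : ∀ K : Finset Omega, ((K ∩ U).card : ℤ) * ((K ∩ U).card - 2) =
          ((K ∩ U).card : ℤ) * ((K ∩ U).card - 1) - (K ∩ U).card := fun K => by ring
      simp only [this, Finset.sum_sub_distrib, hs1, hs2]
      ring
    have hnn : 0 ≤ ∑ K ∈ octadsAvoiding 𝒪 a b c,
        ((K ∩ U).card : ℤ) * ((K ∩ U).card - 2) := by
      refine Finset.sum_nonneg fun K hK => ?_
      obtain ⟨m, hm⟩ := (hpar K₀ hK₀ K hK).1 hev
      rw [hm]
      rcases m with _ | m
      · simp
      · push_cast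
        nlinarith
    rw [hsum] at hnn
    interval_cases U.card <;> omega
  · have hsum : ∑ K ∈ octadsAvoiding 𝒪 a b c,
        (((K ∩ U).card : ℤ) - 1) * ((K ∩ U).card - 3) =
          4 * ((U.card - 6) * (U.card - 7)) := by
      have : ∀ K : Finset Omega, (((K ∩ U).card : ℤ) - 1) * ((K ∩ U).card - 3) =
          ((K ∩ U).card : ℤ) * ((K ∩ U).card - 1) - 3 * (K ∩ U).card + 3 := fun K => by ring
      simp only [this, Finset.sum_sub_distrib, Finset.sum_add_distrib, ← Finset.mul_sum,
        Finset.sum_const, hs0, hs1, hs2]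
      ring
    have hnp : ∑ K ∈ octadsAvoiding 𝒪 a b c,
        (((K ∩ U).card : ℤ) - 1) * ((K ∩ U).card - 3) ≤ 0 := by
      refine Finset.sum_nonpos fun K hK => ?_
      have h1 : ¬ Even (K ∩ U).card := fun h' => hev ((hpar K₀ hK₀ K hK).2 h')
      have h2 : (K ∩ U).card ≤ 4 := (Finset.card_le_card Finset.inter_subset_right).trans h4
      generalize (K ∩ U).card = k at h1 h2
      interval_cases k <;> first | exact absurd (by decide) h1 | norm_num
    rw [hsum] at hnp
    interval_cases U.card <;> omega

end Avoiding

end Steiner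

/-! ### The Leech lattice -/

local notation "ptInf" => (OnePoint.infty : Omega)
local notation "ptZero" => ((0 : ZMod 23) : Omega)
local notation "ptOne" => ((1 : ZMod 23) : Omega)


theorem dotProduct_nu (u : Omega → ℚ) (A : Finset Omega) : u ⬝ᵥ nu A = ∑ i ∈ A, u i := by
  simp [dotProduct, nu]

theorem sum_nu (A K : Finset Omega) : ∑ i ∈ K, nu A i = (A ∩ K).card := by
  simp [nu, Finset.inter_comm]

theorem form_eq (u v : Ambient) :
    form u v = u.1 * v.2.1 + u.2.1 * v.1 - (u.2.2 ⬝ᵥ v.2.2) / 8 := rfl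

theorem form_comm (u v : Ambient) : form u v = form v u := by
  rw [form_eq, form_eq, dotProduct_comm]
  ring

theorem form_smul_left (c : ℚ) (u v : Ambient) : form (c • u) v = c * form u v := by
  simp only [form_eq, Prod.smul_fst, Prod.smul_snd, smul_dotProduct, smul_eq_mul]
  ring

theorem form_sub_left (u u' v : Ambient) : form (u - u') v = form u v - form u' v := by
  simp only [form_eq, Prod.fst_sub, Prod.snd_sub, sub_dotProduct]
  ring

theorem two_nu_mem_leechLattice {𝒪 : Set (Finset Omega)} {K : Finset Omega} (hK : K ∈ 𝒪) :
    (2 : ℚ) • nu K ∈ leechLattice 𝒪 :=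
  Submodule.subset_span (Or.inr ⟨K, hK, rfl⟩)

theorem nu_univ_sub_mem_leechLattice (𝒪 : Set (Finset Omega)) :
    nu Finset.univ - (4 : ℚ) • nu {ptInf} ∈ leechLattice 𝒪 :=
  Submodule.subset_span (Or.inl rfl)

/-- Three disjoint octads show `2 ν_Ω ∈ Λ`, and `8 ν_∞ = 2 ν_Ω - 2 (ν_Ω - 4 ν_∞)`. -/
theorem IsSteinerSystem.eight_nu_mem_leechLattice {𝒪 : Set (Finset Omega)}
    (h : IsSteinerSystem 𝒪) : (8 : ℚ) • nu {ptInf} ∈ leechLattice 𝒪 := by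
  obtain ⟨A, hA, B, hB, C, hC, hAB, rfl⟩ := h.exists_three_disjoint
  have e : (8 : ℚ) • nu {ptInf} = (2 : ℚ) • nu A + (2 : ℚ) • nu B + (2 : ℚ) • nu (A ∪ B)ᶜ -
      (2 : ℤ) • (nu Finset.univ - (4 : ℚ) • nu {ptInf}) := by
    ext i
    have : i ∈ A → i ∉ B := fun h' => Finset.disjoint_left.1 hAB h'
    simp only [nu, Pi.add_apply, Pi.sub_apply, Pi.smul_apply, smul_eq_mul,
      zsmul_eq_mul, Pi.mul_apply, Pi.intCast_apply,
      Finset.mem_compl, Finset.mem_union, Finset.mem_univ]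
    by_cases h1 : i ∈ A <;> by_cases h2 : i ∈ B <;> by_cases h3 : i ∈ ({ptInf} : Finset Omega) <;>
      simp_all <;> norm_num
  rw [e]
  exact sub_mem (add_mem (add_mem (two_nu_mem_leechLattice hA) (two_nu_mem_leechLattice hB))
    (two_nu_mem_leechLattice hC)) (Submodule.smul_mem _ _ (nu_univ_sub_mem_leechLattice 𝒪))

/-- The part of the usual coordinate description of `Λ` that is needed: the coordinates are
integers of equal parity, and as the form is integral, their sum over an octad is divisible
by 4. -/
theorem IsSteinerSystem.exists_int_of_mem_leechLattice {𝒪 : Set (Finset Omega)}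
    (h : IsSteinerSystem 𝒪) {l : Omega → ℚ} (hl : l ∈ leechLattice 𝒪) :
    ∃ z : Omega → ℤ, l = (fun i => (z i : ℚ)) ∧ (∀ i j, Even (z i - z j)) ∧
      ∀ K ∈ 𝒪, 4 ∣ ∑ i ∈ K, z i := by
  induction hl using Submodule.span_induction with
  | mem v hv =>
    rcases hv with rfl | ⟨K, hK, rfl⟩
    · refine ⟨fun i => if i = ptInf then -3 else 1, ?_, ?_, ?_⟩
      · ext i
        by_cases hi : i = ptInf <;> simp [nu, hi]
        norm_num
      · intro i j
        dsimp only
        split_ifs <;> decide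
      · intro K hK
        have : ∀ i : Omega, (if i = ptInf then (-3 : ℤ) else 1) =
            1 - 4 * if i = ptInf then 1 else 0 := by
          intro i; split_ifs <;> norm_num
        simp only [this, Finset.sum_sub_distrib, ← Finset.mul_sum, Finset.sum_const, h.1 K hK]
        exact dvd_sub ⟨2, by norm_num⟩ (dvd_mul_right _ _)
    · refine ⟨fun i => 2 * if i ∈ K then 1 else 0, ?_, ?_, ?_⟩
      · ext i
        simp [nu]
      · intro i j
        rw [← mul_sub]
        exact even_two_mul _
      · intro K' hK'
        obtain ⟨m, hm⟩ := h.even_card_inter hK' hK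
        rw [← Finset.mul_sum, Finset.sum_boole, Finset.filter_mem_eq_inter, hm]
        exact ⟨m, by push_cast; ring⟩
  | zero => exact ⟨0, by ext; simp, by simp, by simp⟩
  | add u v _ _ hu hv =>
    obtain ⟨y, rfl, h1, h2⟩ := hu
    obtain ⟨z, rfl, h3, h4⟩ := hv
    refine ⟨fun i => y i + z i, by ext; simp, fun i j => ?_, fun K hK => ?_⟩
    · rw [add_sub_add_comm]
      exact (h1 i j).add (h3 i j)
    · rw [Finset.sum_add_distrib]
      exact dvd_add (h2 K hK) (h4 K hK)
  | smul c u _ hu =>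
    obtain ⟨y, rfl, h1, h2⟩ := hu
    refine ⟨fun i => c * y i, by ext; simp, fun i j => ?_, fun K hK => ?_⟩
    · rw [← mul_sub]
      exact (h1 i j).mul_left c
    · rw [← Finset.mul_sum]
      exact (h2 K hK).mul_left c

theorem isEvenSet_of_even_sum {𝒪 : Set (Finset Omega)} {y : Omega → ℤ}
    (hy : ∀ K ∈ 𝒪, Even (∑ i ∈ K, y i)) : IsEvenSet 𝒪 (Finset.univ.filter fun i => Odd (y i)) := by
  intro K hK
  have h1 := hy K hK
  have h2 : ((Finset.univ.filter fun i => Odd (y i)) ∩ K).card =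
      ∑ i ∈ K, if Odd (y i) then 1 else 0 := by
    rw [Finset.sum_boole, Nat.cast_id]
    congr 1
    ext i
    simp [and_comm]
  have h3 : Even (∑ i ∈ K, (y i - if Odd (y i) then 1 else 0)) := by
    refine Finset.even_sum _ fun i _ => ?_
    split_ifs with ho
    · exact ho.sub_odd odd_one
    · simpa using ho
  rw [← Int.even_coe_nat, h2]
  push_cast
  rw [Finset.sum_sub_distrib] at h3
  have := h1.sub h3
  rwa [sub_sub_cancel] at this

/-- An even vector of norm 32 in `Λ` with a coordinate 4 has only one other nonzero coordinate:
otherwise halving it would give an even set of size 4. -/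
theorem IsSteinerSystem.not_odd_of_sum_sq_eq {𝒪 : Set (Finset Omega)} (h : IsSteinerSystem 𝒪)
    {y : Omega → ℤ} (hy : ∀ K ∈ 𝒪, Even (∑ i ∈ K, y i)) (h8 : ∑ i, y i ^ 2 = 8)
    {a b : Omega} (ha : y a = 2) : ¬ Odd (y b) := by
  intro hb
  have hba : b ≠ a := by
    rintro rfl
    rw [ha] at hb
    exact absurd hb (by decide)
  have hb1 : 1 ≤ y b ^ 2 := by
    have : y b ≠ 0 := fun h0 => by rw [h0] at hb; exact absurd hb (by decide)
    have := sq_pos_of_ne_zero this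
    omega
  have hle : ∀ s : Finset Omega, ∑ i ∈ s, y i ^ 2 ≤ 8 := fun s =>
    h8 ▸ Finset.sum_le_sum_of_subset_of_nonneg (Finset.subset_univ s) fun i _ _ => sq_nonneg _
  have hsmall : ∀ i, i ≠ a → -1 ≤ y i ∧ y i ≤ 1 := by
    intro i hi
    by_cases hib : i = b
    · subst hib
      have h1 := hle {a, i}
      rw [Finset.sum_pair hi.symm, ha] at h1
      have h2 : y i ≤ 2 := by nlinarith
      have h3 : -2 ≤ y i := by nlinarith
      obtain ⟨m, hm⟩ := hb
      omega
    · have h1 := hle {a, b, i}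
      rw [Finset.sum_insert (by simp [hba.symm, hi.symm]), Finset.sum_pair (Ne.symm hib), ha] at h1
      constructor <;> nlinarith
  refine h.card_ne_four (isEvenSet_of_even_sum hy) ?_
  have hsum : ∑ i, y i ^ 2 = ∑ i, ((if Odd (y i) then 1 else 0) + if i = a then 4 else 0) := by
    refine Finset.sum_congr rfl fun i _ => ?_
    by_cases hi : i = a
    · subst hi
      rw [ha, if_neg (by decide), if_pos rfl]
      norm_num
    · rw [if_neg hi]
      obtain ⟨h1, h2⟩ := hsmall i hi
      interval_cases y i <;> simp
  rw [h8, Finset.sum_add_distrib, Finset.sum_boole] at hsum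
  simp only [Finset.sum_ite_eq', Finset.mem_univ, if_true] at hsum
  have : ((Finset.univ.filter fun i => Odd (y i)).card : ℤ) = 4 := by linarith
  exact_mod_cast this

/-- An odd vector of norm 32 in `Λ` with a coordinate 3 has all other coordinates `±1`, and the
places of `-1` together with that of 3 form an even set. -/
theorem IsSteinerSystem.exists_isEvenSet_of_odd {𝒪 : Set (Finset Omega)} (h : IsSteinerSystem 𝒪)
    {z : Omega → ℤ} (hz : ∀ K ∈ 𝒪, 4 ∣ ∑ i ∈ K, z i) (hodd : ∀ i, Odd (z i))
    (h32 : ∑ i, z i ^ 2 = 32) {a : Omega} (ha : z a = 3) :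
    ∃ Y, IsEvenSet 𝒪 Y ∧ a ∈ Y ∧
      ∀ i, z i = 1 - 2 * (if i ∈ Y then 1 else 0) + 4 * (if i = a then 1 else 0) := by
  have h1 : ∀ i, 1 ≤ z i ^ 2 := fun i => by
    have : z i ≠ 0 := fun h0 => by have := hodd i; rw [h0] at this; exact absurd this (by decide)
    have := sq_pos_of_ne_zero this
    omega
  have hpm : ∀ i, i ≠ a → z i = 1 ∨ z i = -1 := by
    have h2 : ∑ i ∈ Finset.univ.erase a, (1 : ℤ) = ∑ i ∈ Finset.univ.erase a, z i ^ 2 := by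
      have h3 := Finset.add_sum_erase Finset.univ (fun i => z i ^ 2) (Finset.mem_univ a)
      rw [h32, ha] at h3
      rw [Finset.sum_const, Finset.card_erase_of_mem (Finset.mem_univ a), Finset.card_univ,
        card_omega, nsmul_eq_mul]
      push_cast
      linarith
    intro i hi
    have h3 := (Finset.sum_eq_sum_iff_of_le fun i _ => h1 i).1 h2 i
      (Finset.mem_erase.2 ⟨hi, Finset.mem_univ i⟩)
    exact sq_eq_one_iff.1 h3.symm
  have hform : ∀ i, z i = 1 - 2 * (if i ∈ Finset.univ.filter (fun i => z i = -1 ∨ i = a)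
      then 1 else 0) + 4 * (if i = a then 1 else 0) := by
    intro i
    by_cases hi : i = a
    · simp [hi, ha]
    · rcases hpm i hi with h' | h' <;> simp [hi, h']
  refine ⟨Finset.univ.filter fun i => z i = -1 ∨ i = a, fun K hK => ?_, by simp, hform⟩
  have h4 := hz K hK
  rw [Finset.sum_congr rfl fun i _ => hform i, Finset.sum_add_distrib, Finset.sum_sub_distrib,
    ← Finset.mul_sum, ← Finset.mul_sum, Finset.sum_boole, Finset.filter_mem_eq_inter,
    Finset.sum_const, h.1 K hK, Finset.inter_comm] at h4
  rw [← Int.even_coe_nat, even_iff_two_dvd]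
  simp only [nsmul_eq_mul, Nat.cast_ofNat, mul_one] at h4
  generalize ∑ i ∈ K, (if i = a then (1 : ℤ) else 0) = s at h4
  omega

/-! ### The lattice `S` in coordinates -/

theorem ptZero_ne_ptInf : ptZero ≠ ptInf := OnePoint.coe_ne_infty _

theorem ptOne_ne_ptInf : ptOne ≠ ptInf := OnePoint.coe_ne_infty _

theorem ptZero_ne_ptOne : ptZero ≠ ptOne := by
  rw [Ne, OnePoint.coe_eq_coe]
  decide

/-- The 21 points of `Ω` other than `∞`, `0` and `1`. -/
def otherPoints : Finset Omega := {ptInf, ptZero, ptOne}ᶜ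

theorem mem_otherPoints {i : Omega} :
    i ∈ otherPoints ↔ i ≠ ptInf ∧ i ≠ ptZero ∧ i ≠ ptOne := by
  simp [otherPoints]

theorem card_otherPoints : otherPoints.card = 21 := by
  rw [otherPoints, Finset.card_compl, card_omega, Finset.card_eq_three.2
    ⟨_, _, _, ptZero_ne_ptInf.symm, ptOne_ne_ptInf.symm, ptZero_ne_ptOne, rfl⟩]

theorem sum_univ_eq_add {M : Type*} [AddCommMonoid M] (f : Omega → M) :
    ∑ i, f i = f ptInf + f ptZero + f ptOne + ∑ i ∈ otherPoints, f i := by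
  rw [otherPoints, ← Finset.sum_add_sum_compl {ptInf, ptZero, ptOne},
    Finset.sum_insert (by simp [ptZero_ne_ptInf.symm, ptOne_ne_ptInf.symm]),
    Finset.sum_pair ptZero_ne_ptOne, ← add_assoc]

theorem form_rootX (v : Ambient) :
    form v rootX = v.1 + 2 * v.2.1 - (4 * v.2.2 ptInf + ∑ i, v.2.2 i) / 8 := by
  simp only [form_eq, rootX, dotProduct_add, dotProduct_smul, dotProduct_nu,
    Finset.sum_singleton, smul_eq_mul]
  ring

theorem form_rootZ (v : Ambient) : form v rootZ = v.1 - v.2.1 := by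
  simp only [form_eq, rootZ, dotProduct_zero]
  ring

theorem form_rootP (v : Ambient) :
    form v rootP = v.1 + v.2.1 - (v.2.2 ptInf + v.2.2 ptZero) / 2 := by
  simp only [form_eq, rootP, dotProduct_add, dotProduct_smul, dotProduct_nu,
    Finset.sum_singleton, smul_eq_mul]
  ring

theorem form_rootQ (v : Ambient) :
    form v rootQ = v.1 + v.2.1 - (∑ i, v.2.2 i - 4 * v.2.2 ptOne) / 8 := by
  simp only [form_eq, rootQ, dotProduct_sub, dotProduct_smul, dotProduct_nu,
    Finset.sum_singleton, smul_eq_mul]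
  ring

theorem form_weylVector (v : Ambient) : form v weylVector = v.2.1 := by
  simp only [form_eq, weylVector, dotProduct_zero]
  ring

theorem forall_form_latticeR_eq_zero_iff {v : Ambient} :
    (∀ s ∈ latticeR, form v s = 0) ↔
      form v rootX = 0 ∧ form v rootZ = 0 ∧ form v rootP = 0 ∧ form v rootQ = 0 := by
  constructor
  · intro h
    refine ⟨h _ (Submodule.subset_span ?_), h _ (Submodule.subset_span ?_),
      h _ (Submodule.subset_span ?_), h _ (Submodule.subset_span ?_)⟩ <;> simp
  · rintro ⟨h1, h2, h3, h4⟩ s hs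
    rw [form_comm]
    induction hs using Submodule.span_induction with
    | mem u hu => rcases hu with rfl | rfl | rfl | rfl <;> rwa [form_comm]
    | zero => exact form_zero_left v
    | add a b _ _ ha hb => rw [form_add_left, ha, hb, add_zero]
    | smul c a _ ha => rw [form_zsmul_left, ha, mul_zero]

theorem mem_latticeS_iff {𝒪 : Set (Finset Omega)} {v : Ambient} :
    v ∈ latticeS 𝒪 ↔ v ∈ latticeII 𝒪 ∧
      form v rootX = 0 ∧ form v rootZ = 0 ∧ form v rootP = 0 ∧ form v rootQ = 0 := by
  rw [← forall_form_latticeR_eq_zero_iff]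
  rfl

theorem mem_leechRootsPerp_iff {𝒪 : Set (Finset Omega)} {r : Ambient} :
    r ∈ leechRootsPerp 𝒪 ↔ r ∈ latticeS 𝒪 ∧ form r r = -2 ∧ r.2.1 = 1 := by
  rw [← form_weylVector]
  change ((_ ∧ _ ∧ _) ∧ _) ↔ (_ ∧ _) ∧ _ ∧ _
  tauto

theorem mem_latticeII_iff {𝒪 : Set (Finset Omega)} {v : Ambient} :
    v ∈ latticeII 𝒪 ↔ (∃ m : ℤ, (m : ℚ) = v.1) ∧ (∃ n : ℤ, (n : ℚ) = v.2.1) ∧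
      v.2.2 ∈ leechLattice 𝒪 := by
  simp [latticeII, Submodule.mem_prod, Submodule.mem_span_singleton]

/-- The description of `S` in integral coordinates; orthogonality to the four roots of `R`
becomes `m = n` and three linear equations for the Leech component. -/
theorem IsSteinerSystem.exists_int_of_mem_latticeS {𝒪 : Set (Finset Omega)}
    (h : IsSteinerSystem 𝒪) {v : Ambient} (hv : v ∈ latticeS 𝒪) :
    ∃ (m : ℤ) (z : Omega → ℤ), v = ((m : ℚ), (m : ℚ), fun i => (z i : ℚ)) ∧
      (∀ i j, Even (z i - z j)) ∧ (∀ K ∈ 𝒪, 4 ∣ ∑ i ∈ K, z i) ∧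
      z ptInf + z ptZero = 4 * m ∧ z ptInf + z ptOne = 2 * m ∧
      ∑ i, z i + 4 * z ptInf = 24 * m := by
  rw [mem_latticeS_iff, mem_latticeII_iff, form_rootX, form_rootZ, form_rootP, form_rootQ] at hv
  obtain ⟨m, n, l⟩ := v
  obtain ⟨⟨⟨m, rfl⟩, ⟨n, rfl⟩, hl⟩, h1, h2, h3, h4⟩ := hv
  obtain ⟨z, rfl, hz1, hz2⟩ := h.exists_int_of_mem_leechLattice hl
  dsimp only at h1 h2 h3 h4
  have h2' : m = n := by exact_mod_cast sub_eq_zero.1 h2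
  subst h2'
  refine ⟨m, z, rfl, hz1, hz2, ?_, ?_, ?_⟩
  · have : (z ptInf : ℚ) + z ptZero = 4 * m := by linarith
    exact_mod_cast this
  · have : (z ptInf : ℚ) + z ptOne = 2 * m := by linarith
    exact_mod_cast this
  · have : ∑ i, (z i : ℚ) + 4 * z ptInf = 24 * m := by linarith
    exact_mod_cast this

/-! ### The 112 Leech roots orthogonal to `R` -/

/-- The Leech root `(1, 1, 2 ν_K)`. -/
def evenRoot (K : Finset Omega) : Ambient := (1, 1, (2 : ℚ) • nu K)

/-- The Leech root `(1, 1, ν_Ω - 2 ν_K + 4 ν_∞)`. -/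
def oddRoot (K : Finset Omega) : Ambient :=
  (1, 1, nu Finset.univ - (2 : ℚ) • nu K + (4 : ℚ) • nu {ptInf})

theorem form_evenRoot_evenRoot (K K' : Finset Omega) :
    form (evenRoot K) (evenRoot K') = 2 - ((K ∩ K').card : ℚ) / 2 := by
  simp only [form_eq, evenRoot, dotProduct_smul, smul_dotProduct, dotProduct_nu, sum_nu,
    smul_eq_mul]
  ring

theorem form_oddRoot_oddRoot {K K' : Finset Omega} (hK : K.card = 8) (hK' : K'.card = 8)
    (hi : ptInf ∈ K) (hi' : ptInf ∈ K') :
    form (oddRoot K) (oddRoot K') = 2 - ((K ∩ K').card : ℚ) / 2 := by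
  simp only [form_eq, oddRoot, dotProduct_smul, smul_dotProduct, dotProduct_nu, sum_nu,
    smul_eq_mul, dotProduct_add, dotProduct_sub, add_dotProduct, sub_dotProduct,
    Finset.univ_inter, Finset.inter_univ, Finset.card_univ, card_omega, hK, hK',
    Finset.singleton_inter_of_mem hi', Finset.inter_singleton_of_mem hi, Finset.inter_self,
    Finset.card_singleton]
  push_cast
  ring

theorem form_evenRoot_oddRoot {K K' : Finset Omega} (hK : K.card = 8) (hi : ptInf ∈ K) :
    form (evenRoot K) (oddRoot K') = ((K ∩ K').card : ℚ) / 2 - 1 := by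
  simp only [form_eq, oddRoot, evenRoot, dotProduct_smul, smul_dotProduct, dotProduct_nu, sum_nu,
    smul_eq_mul, dotProduct_add, dotProduct_sub,
    Finset.inter_univ, hK, Finset.inter_singleton_of_mem hi, Finset.card_singleton]
  push_cast
  ring

section Roots

variable {𝒪 : Set (Finset Omega)} (h : IsSteinerSystem 𝒪)
include h

theorem IsSteinerSystem.evenRoot_mem {K : Finset Omega}
    (hK : K ∈ octadsAvoiding 𝒪 ptInf ptZero ptOne) : evenRoot K ∈ leechRootsPerp 𝒪 := by
  rw [mem_octadsAvoiding] at hK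
  obtain ⟨hK, hi, h0, h1⟩ := hK
  have hs : ∑ i, nu K i = 8 := by rw [sum_nu, Finset.inter_univ, h.1 K hK]; norm_num
  rw [mem_leechRootsPerp_iff, mem_latticeS_iff, mem_latticeII_iff, form_evenRoot_evenRoot,
    form_rootX, form_rootZ, form_rootP, form_rootQ, Finset.inter_self, h.1 K hK]
  refine ⟨⟨⟨⟨1, by simp [evenRoot]⟩, ⟨1, by simp [evenRoot]⟩, two_nu_mem_leechLattice hK⟩, ?_⟩,
    by norm_num, rfl⟩
  simp only [evenRoot, Pi.smul_apply, smul_eq_mul, ← Finset.mul_sum, hs]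
  simp only [nu, hi, h0, h1]
  norm_num

theorem IsSteinerSystem.oddRoot_mem {K : Finset Omega}
    (hK : K ∈ octadsAvoiding 𝒪 ptInf ptOne ptZero) : oddRoot K ∈ leechRootsPerp 𝒪 := by
  rw [mem_octadsAvoiding] at hK
  obtain ⟨hK, hi, h1, h0⟩ := hK
  have hs : ∑ i, nu K i = 8 := by rw [sum_nu, Finset.inter_univ, h.1 K hK]; norm_num
  have hl : nu Finset.univ - (2 : ℚ) • nu K + (4 : ℚ) • nu {ptInf} ∈ leechLattice 𝒪 := by
    have e : nu Finset.univ - (2 : ℚ) • nu K + (4 : ℚ) • nu {ptInf} =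
        nu Finset.univ - (4 : ℚ) • nu {ptInf} - (2 : ℚ) • nu K + (8 : ℚ) • nu {ptInf} := by
      module
    rw [e]
    exact add_mem (sub_mem (nu_univ_sub_mem_leechLattice 𝒪) (two_nu_mem_leechLattice hK))
      h.eight_nu_mem_leechLattice
  rw [mem_leechRootsPerp_iff, mem_latticeS_iff, mem_latticeII_iff,
    form_oddRoot_oddRoot (h.1 K hK) (h.1 K hK) hi hi,
    form_rootX, form_rootZ, form_rootP, form_rootQ, Finset.inter_self, h.1 K hK]
  refine ⟨⟨⟨⟨1, by simp [oddRoot]⟩, ⟨1, by simp [oddRoot]⟩, hl⟩, ?_⟩, by norm_num, rfl⟩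
  simp only [oddRoot, Pi.add_apply, Pi.sub_apply, Pi.smul_apply, smul_eq_mul,
    Finset.sum_add_distrib, Finset.sum_sub_distrib, ← Finset.mul_sum, hs]
  simp only [sum_nu, Finset.inter_univ, Finset.card_univ, card_omega, Finset.card_singleton]
  simp [nu, hi, h0, h1]
  norm_num

/-- The Leech component of a Leech root orthogonal to `R` is a vector of norm 32 with prescribed
values of three linear forms. If it is even, its coordinate at `∞` is 2 and it is `2 ν_K`; if it
is odd, that coordinate is 3 and it is `ν_Ω - 2 ν_K + 4 ν_∞`. The other values at `∞` that the norm
allows would produce an even set of size 4. -/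
theorem IsSteinerSystem.eq_evenRoot_or_oddRoot {r : Ambient} (hr : r ∈ leechRootsPerp 𝒪) :
    (∃ K ∈ octadsAvoiding 𝒪 ptInf ptZero ptOne, evenRoot K = r) ∨
      ∃ K ∈ octadsAvoiding 𝒪 ptInf ptOne ptZero, oddRoot K = r := by
  rw [mem_leechRootsPerp_iff] at hr
  obtain ⟨hS, hn, hm1⟩ := hr
  obtain ⟨m, z, rfl, hpar, h4, e0, e1, es⟩ := h.exists_int_of_mem_latticeS hS
  dsimp only at hm1
  obtain rfl : m = 1 := by exact_mod_cast hm1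
  have h32 : ∑ i, z i ^ 2 = 32 := by
    have : ∑ i, (z i : ℚ) ^ 2 = 32 := by
      simp only [form, ← pow_two] at hn
      push_cast at hn
      linarith
    exact_mod_cast this
  have hsplit := sum_univ_eq_add fun i => z i ^ 2
  rcases Int.even_or_odd (z ptInf) with hev | hodd
  · left
    have hall : ∀ i, ∃ y : ℤ, z i = 2 * y := fun i => by
      obtain ⟨a, ha⟩ := hev
      obtain ⟨b, hb⟩ := hpar i ptInf
      exact ⟨a + b, by omega⟩
    choose y hy using hall
    have hyK : ∀ K ∈ 𝒪, Even (∑ i ∈ K, y i) := fun K hK => by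
      have := h4 K hK
      simp only [hy, ← Finset.mul_sum] at this
      rw [even_iff_two_dvd]
      omega
    have hy8 : ∑ i, y i ^ 2 = 8 := by
      simp only [hy, mul_pow, ← Finset.mul_sum] at h32
      omega
    simp only [hy, ← Finset.mul_sum] at e0 e1 es
    have hysplit := sum_univ_eq_add fun i => y i ^ 2
    have hnn : 0 ≤ ∑ i ∈ otherPoints, y i ^ 2 := Finset.sum_nonneg fun i _ => sq_nonneg _
    have a0 : y ptZero = 2 - y ptInf := by omega
    have a1 : y ptOne = 1 - y ptInf := by omega
    simp only [hy8, a0, a1] at hysplit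
    have b1 : y ptInf ≤ 2 := by nlinarith
    have b2 : 0 ≤ y ptInf := by nlinarith
    have hyI : y ptInf = 1 := by
      interval_cases hI : y ptInf
      · exact absurd (by rw [a1]; decide) (h.not_odd_of_sum_sq_eq hyK hy8 a0 (b := ptOne))
      · rfl
      · exact absurd (by rw [a1]; decide) (h.not_odd_of_sum_sq_eq hyK hy8 hI (b := ptOne))
    have h01 : ∀ i, y i = 0 ∨ y i = 1 := by
      have hz : ∑ i, y i * (y i - 1) = 0 := by
        have : ∀ i, y i * (y i - 1) = y i ^ 2 - y i := fun i => by ring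
        simp only [this, Finset.sum_sub_distrib]
        omega
      have hge : ∀ i ∈ Finset.univ, 0 ≤ y i * (y i - 1) := fun i _ => by
        rcases le_or_gt (y i) 0 with h' | h' <;> nlinarith
      intro i
      rcases mul_eq_zero.1 ((Finset.sum_eq_zero_iff_of_nonneg hge).1 hz i (Finset.mem_univ i))
        with h' | h' <;> omega
    have hodd1 : ∀ i, Odd (y i) ↔ y i = 1 := fun i => by
      rcases h01 i with h' | h' <;> simp [h']
    have hyind : ∀ i, y i = if Odd (y i) then 1 else 0 := fun i => by
      rcases h01 i with h' | h' <;> simp [h']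
    have hcard : (Finset.univ.filter fun i => Odd (y i)).card = 8 := by
      have h' : ∑ i, y i = ∑ i, if Odd (y i) then 1 else 0 :=
        Finset.sum_congr rfl fun i _ => hyind i
      rw [Finset.sum_boole] at h'
      have : ((Finset.univ.filter fun i => Odd (y i)).card : ℤ) = 8 := by omega
      exact_mod_cast this
    refine ⟨Finset.univ.filter fun i => Odd (y i), ?_, ?_⟩
    · rw [mem_octadsAvoiding]
      refine ⟨h.mem_of_isEvenSet (isEvenSet_of_even_sum hyK) hcard, ?_, ?_, ?_⟩
      · simp [hyI]
      · simp [a0, hyI]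
      · simp [a1, hyI]
    · rw [evenRoot, Int.cast_one]
      congr 2
      ext i
      rw [hy i]
      rcases h01 i with h' | h' <;> simp [nu, h']
  · right
    have hall : ∀ i, Odd (z i) := fun i => by
      have := (hpar i ptInf).add_odd hodd
      rwa [sub_add_cancel] at this
    have hge : (21 : ℤ) ≤ ∑ i ∈ otherPoints, z i ^ 2 := by
      have : ∑ i ∈ otherPoints, (1 : ℤ) ≤ ∑ i ∈ otherPoints, z i ^ 2 := by
        refine Finset.sum_le_sum fun i _ => ?_
        have h0 : z i ≠ 0 := fun h0 => by
          have := hall i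
          rw [h0] at this
          exact absurd this (by decide)
        have := sq_pos_of_ne_zero h0
        omega
      rwa [Finset.sum_const, card_otherPoints, nsmul_eq_mul, mul_one] at this
    have a0 : z ptZero = 4 - z ptInf := by omega
    have a1 : z ptOne = 2 - z ptInf := by omega
    simp only [h32, a0, a1] at hsplit
    have b1 : z ptInf ≤ 3 := by nlinarith
    have b2 : 1 ≤ z ptInf := by nlinarith
    have hcard : ∀ {Y : Finset Omega} {a : Omega},
        (∀ i, z i = 1 - 2 * (if i ∈ Y then 1 else 0) + 4 * (if i = a then 1 else 0)) →
        ∑ i, z i = 28 - 2 * Y.card := by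
      intro Y a hY
      rw [Finset.sum_congr rfl fun i _ => hY i, Finset.sum_add_distrib, Finset.sum_sub_distrib,
        ← Finset.mul_sum, ← Finset.mul_sum, Finset.sum_boole, Finset.filter_mem_eq_inter,
        Finset.sum_const, Finset.card_univ, card_omega, Finset.univ_inter, Finset.sum_ite_eq',
        if_pos (Finset.mem_univ a), nsmul_eq_mul]
      push_cast
      ring
    have hI : z ptInf = 3 := by
      obtain ⟨k, hk⟩ := hodd
      by_contra hne
      have hI1 : z ptInf = 1 := by omega
      obtain ⟨Y, hY, -, hz⟩ := h.exists_isEvenSet_of_odd h4 hall h32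
        (show z ptZero = 3 by rw [a0, hI1]; norm_num)
      have := hcard hz
      exact h.card_ne_four hY (by omega)
    obtain ⟨Y, hY, hIY, hz⟩ := h.exists_isEvenSet_of_odd h4 hall h32 hI
    have hs := hcard hz
    refine ⟨Y, ?_, ?_⟩
    · rw [mem_octadsAvoiding]
      have h0 := hz ptZero
      have h1 := hz ptOne
      rw [a0, hI, if_neg ptZero_ne_ptInf] at h0
      rw [a1, hI, if_neg ptOne_ne_ptInf] at h1
      refine ⟨h.mem_of_isEvenSet hY (by omega), hIY, ?_, ?_⟩
      · by_contra h'
        simp [h'] at h1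
      · intro h'
        simp [h'] at h0
    · rw [oddRoot, Int.cast_one]
      congr 2
      ext i
      rw [hz i]
      simp [nu]

end Roots

/-! ### The roots generate `S` -/

/-- The indicator vector of `A` with integer values. -/
def intNu (A : Finset Omega) : Omega → ℤ := fun i => if i ∈ A then 1 else 0

/-- The embedding `y ↦ (0, 0, 2 y)`. -/
def doubled : (Omega → ℤ) →+ Ambient where
  toFun y := (0, 0, fun i => 2 * (y i : ℚ))
  map_zero' := by ext <;> simp
  map_add' x y := by ext <;> simp [mul_add]

theorem doubled_apply (y : Omega → ℤ) : doubled y = (0, 0, fun i => 2 * (y i : ℚ)) := rfl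

/-- The integer vectors `y` vanishing at `∞` such that `(0, 0, 2 y)` is an integral combination of
the Leech roots orthogonal to `R`. -/
def rootCombinations (𝒪 : Set (Finset Omega)) : AddSubgroup (Omega → ℤ) :=
  (Submodule.span ℤ (leechRootsPerp 𝒪)).toAddSubgroup.comap doubled ⊓
    (Pi.evalAddMonoidHom (fun _ : Omega => ℤ) ptInf).ker

theorem mem_rootCombinations {𝒪 : Set (Finset Omega)} {y : Omega → ℤ} :
    y ∈ rootCombinations 𝒪 ↔
      doubled y ∈ Submodule.span ℤ (leechRootsPerp 𝒪) ∧ y ptInf = 0 := Iff.rfl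

theorem span_leechRootsPerp_le (𝒪 : Set (Finset Omega)) :
    Submodule.span ℤ (leechRootsPerp 𝒪) ≤ latticeS 𝒪 :=
  Submodule.span_le.2 fun _ hr => (mem_leechRootsPerp_iff.1 hr).1

section Generation

variable {𝒪 : Set (Finset Omega)} (h : IsSteinerSystem 𝒪)
include h

theorem IsSteinerSystem.sub_mem_of_even {K K' : Finset Omega}
    (hK : K ∈ octadsAvoiding 𝒪 ptInf ptZero ptOne)
    (hK' : K' ∈ octadsAvoiding 𝒪 ptInf ptZero ptOne) :
    intNu K - intNu K' ∈ rootCombinations 𝒪 := by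
  refine mem_rootCombinations.2 ⟨?_, ?_⟩
  · have e : doubled (intNu K - intNu K') = evenRoot K - evenRoot K' := by
      ext i
      · simp [doubled_apply, evenRoot]
      · simp [doubled_apply, evenRoot]
      · simp [doubled_apply, evenRoot, intNu, nu]
        split_ifs <;> norm_num
    rw [e]
    exact sub_mem (Submodule.subset_span (h.evenRoot_mem hK))
      (Submodule.subset_span (h.evenRoot_mem hK'))
  · rw [mem_octadsAvoiding] at hK hK'
    simp [intNu, hK.2.1, hK'.2.1]

theorem IsSteinerSystem.sub_mem_of_odd {K K' : Finset Omega}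
    (hK : K ∈ octadsAvoiding 𝒪 ptInf ptOne ptZero)
    (hK' : K' ∈ octadsAvoiding 𝒪 ptInf ptOne ptZero) :
    intNu K - intNu K' ∈ rootCombinations 𝒪 := by
  refine mem_rootCombinations.2 ⟨?_, ?_⟩
  · have e : doubled (intNu K - intNu K') = oddRoot K' - oddRoot K := by
      ext i
      · simp [doubled_apply, oddRoot]
      · simp [doubled_apply, oddRoot]
      · simp [doubled_apply, oddRoot, intNu, nu]
        split_ifs <;> norm_num
    rw [e]
    exact sub_mem (Submodule.subset_span (h.oddRoot_mem hK'))
      (Submodule.subset_span (h.oddRoot_mem hK))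
  · rw [mem_octadsAvoiding] at hK hK'
    simp [intNu, hK.2.1, hK'.2.1]

theorem IsSteinerSystem.exists_octad_notMem {T : Finset Omega} (hT : T.card = 4) {d : Omega}
    (hd : d ∉ T) : ∃ K ∈ 𝒪, T ⊆ K ∧ d ∉ K := by
  have h1 := h.card_octadsThrough hT (by omega) (by omega)
  have h2 := h.card_octadsThrough (T := insert d T)
    (by rw [Finset.card_insert_of_notMem hd, hT]) (by omega) (by omega)
  by_contra! hall
  rw [octadsThrough_insert, Finset.filter_true_of_mem fun K hK =>
    hall K (mem_octadsThrough.1 hK).1 (mem_octadsThrough.1 hK).2, h1] at h2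
  simp [octadCount] at h2

theorem IsSteinerSystem.inter_eq_of_subset {K K' T : Finset Omega} (hK : K ∈ 𝒪) (hK' : K' ∈ 𝒪)
    (hne : K ≠ K') (hT : T.card = 4) (hTK : T ⊆ K) (hTK' : T ⊆ K') : K ∩ K' = T :=
  (Finset.eq_of_subset_of_card_le (Finset.subset_inter hTK hTK')
    (by rw [hT]; exact h.card_inter_le_four hK hK' hne)).symm

/-- Let `A ∋ ∞, 0` and `B ∋ ∞, 1` be octads of the two kinds that meet in `∞` and a 3-set `T`, and
let `D` be the octad through `T`, `i ∈ A` and `j ∈ B`. Then `A ∆ D` and `B ∆ D` are octads of the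
same kinds as `A` and `B`, and the four roots combine to `4 (ν_i - ν_j)`. -/
theorem IsSteinerSystem.two_single_sub_single_mem_of_octads {A B T : Finset Omega} {i j : Omega}
    (hA : A ∈ octadsAvoiding 𝒪 ptInf ptZero ptOne)
    (hB : B ∈ octadsAvoiding 𝒪 ptInf ptOne ptZero)
    (hT : T.card = 3) (hIT : ptInf ∉ T) (hAB : A ∩ B = insert ptInf T)
    (hiA : i ∈ A) (hiB : i ∉ B) (hi0 : i ≠ ptZero) (hjB : j ∈ B) (hjA : j ∉ A) (hj1 : j ≠ ptOne) :
    (2 : ℤ) • (intNu {i} - intNu {j}) ∈ rootCombinations 𝒪 := by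
  have hA' := mem_octadsAvoiding.1 hA
  have hB' := mem_octadsAvoiding.1 hB
  have hTA : T ⊆ A := fun x hx =>
    (Finset.mem_inter.1 (hAB ▸ Finset.mem_insert_of_mem hx)).1
  have hTB : T ⊆ B := fun x hx =>
    (Finset.mem_inter.1 (hAB ▸ Finset.mem_insert_of_mem hx)).2
  have hiT : i ∉ T := fun h' => hiB (hTB h')
  have hjT : j ∉ T := fun h' => hjA (hTA h')
  have hij : i ≠ j := fun h' => hjA (h' ▸ hiA)
  have hiI : i ≠ ptInf := fun h' => hiB (h' ▸ hB'.2.1)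
  have hjI : j ≠ ptInf := fun h' => hjA (h' ▸ hA'.2.1)
  obtain ⟨D, ⟨hD, hsub⟩, -⟩ := h.2 (insert i (insert j T)) (by
    rw [Finset.card_insert_of_notMem (by simp [hij, hiT]), Finset.card_insert_of_notMem hjT, hT])
  rw [Finset.insert_subset_iff, Finset.insert_subset_iff] at hsub
  obtain ⟨hiD, hjD, hTD⟩ := hsub
  have cA : (insert i T).card = 4 := by rw [Finset.card_insert_of_notMem hiT, hT]
  have cB : (insert j T).card = 4 := by rw [Finset.card_insert_of_notMem hjT, hT]
  have hAD := h.inter_eq_of_subset hA'.1 hD (fun e => hjA (e ▸ hjD)) cA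
    (Finset.insert_subset hiA hTA) (Finset.insert_subset hiD hTD)
  have hBD := h.inter_eq_of_subset hB'.1 hD (fun e => hiB (e ▸ hiD)) cB
    (Finset.insert_subset hjB hTB) (Finset.insert_subset hjD hTD)
  have memA := fun x => Finset.ext_iff.1 hAD x
  have memB := fun x => Finset.ext_iff.1 hBD x
  simp only [Finset.mem_inter, Finset.mem_insert] at memA memB
  have hID : ptInf ∉ D := fun h' => by
    rcases (memA _).1 ⟨hA'.2.1, h'⟩ with e | e
    exacts [hiI e.symm, hIT e]
  have h0D : ptZero ∉ D := fun h' => by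
    rcases (memA _).1 ⟨hA'.2.2.1, h'⟩ with e | e
    exacts [hi0 e.symm, hB'.2.2.2 (hTB e)]
  have h1D : ptOne ∉ D := fun h' => by
    rcases (memB _).1 ⟨hB'.2.2.1, h'⟩ with e | e
    exacts [hj1 e.symm, hA'.2.2.2 (hTA e)]
  have hA2 : symmDiff A D ∈ octadsAvoiding 𝒪 ptInf ptZero ptOne := by
    rw [mem_octadsAvoiding]
    refine ⟨h.symmDiff_mem hA'.1 hD (by rw [hAD, cA]), ?_, ?_, ?_⟩ <;>
      simp [Finset.mem_symmDiff, hA', hID, h0D, h1D]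
  have hB2 : symmDiff B D ∈ octadsAvoiding 𝒪 ptInf ptOne ptZero := by
    rw [mem_octadsAvoiding]
    refine ⟨h.symmDiff_mem hB'.1 hD (by rw [hBD, cB]), ?_, ?_, ?_⟩ <;>
      simp [Finset.mem_symmDiff, hB', hID, h0D, h1D]
  have e : (2 : ℤ) • (intNu {i} - intNu {j}) =
      (intNu A - intNu (symmDiff A D)) - (intNu B - intNu (symmDiff B D)) := by
    -- `ν_A - ν_(A ∆ D) = 2 ν_(A ∩ D) - ν_D`
    have key : ∀ A : Finset Omega, intNu A - intNu (symmDiff A D) =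
        (2 : ℤ) • intNu (A ∩ D) - intNu D := by
      intro A
      ext x
      by_cases h1 : x ∈ A <;> by_cases h2 : x ∈ D <;> simp [intNu, Finset.mem_symmDiff, h1, h2]
    have ins : ∀ k, k ∉ T → intNu (insert k T) = intNu {k} + intNu T := by
      intro k hk
      ext x
      by_cases h1 : x = k
      · subst h1
        simp [intNu, hk]
      · simp [intNu, h1]
    rw [key, key, hAD, hBD, ins i hiT, ins j hjT]
    module
  rw [e]
  exact sub_mem (h.sub_mem_of_even hA hA2) (h.sub_mem_of_odd hB hB2)

theorem IsSteinerSystem.two_single_sub_single_mem {i j : Omega} (hi : i ∈ otherPoints)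
    (hj : j ∈ otherPoints) : (2 : ℤ) • (intNu {i} - intNu {j}) ∈ rootCombinations 𝒪 := by
  rcases eq_or_ne i j with rfl | hij
  · rw [sub_self, smul_zero]
    exact zero_mem _
  rw [mem_otherPoints] at hi hj
  obtain ⟨hiI, hi0, hi1⟩ := hi
  obtain ⟨hjI, hj0, hj1⟩ := hj
  have c4 : ({ptInf, ptZero, i, j} : Finset Omega).card = 4 := by
    rw [Finset.card_insert_of_notMem (by simp [ptZero_ne_ptInf.symm, hiI.symm, hjI.symm]),
      Finset.card_insert_of_notMem (by simp [hi0.symm, hj0.symm]), Finset.card_pair hij]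
  obtain ⟨A, hA, hsub, h1A⟩ := h.exists_octad_notMem c4 (d := ptOne)
    (by simp [ptZero_ne_ptOne.symm, hi1.symm, hj1.symm])
  -- the 3-set `T` in which `A` meets the auxiliary octad `B` besides `∞`
  obtain ⟨T, hTA, hT⟩ := Finset.exists_subset_card_eq (s := A \ {ptInf, ptZero, i, j}) (n := 3)
    (by rw [Finset.card_sdiff_of_subset hsub, h.1 A hA, c4]; omega)
  simp only [Finset.insert_subset_iff, Finset.singleton_subset_iff] at hsub
  obtain ⟨hIA, h0A, hiA, hjA⟩ := hsub
  have hTm : ∀ x ∈ T, x ∈ A ∧ x ≠ ptInf ∧ x ≠ ptZero ∧ x ≠ i ∧ x ≠ j := fun x hx => by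
    have := hTA hx
    simpa using this
  have hIT : ptInf ∉ T := fun h' => (hTm _ h').2.1 rfl
  have h1T : ptOne ∉ T := fun h' => h1A (hTm _ h').1
  have c5 : (insert ptOne (insert ptInf T)).card = 5 := by
    rw [Finset.card_insert_of_notMem (by simp [h1T]),
      Finset.card_insert_of_notMem hIT, hT]
  obtain ⟨B, ⟨hB, hsubB⟩, -⟩ := h.2 _ c5
  obtain ⟨k, hkB, hk⟩ := Finset.exists_mem_notMem_of_card_lt_card
    (show (insert ptOne (insert ptInf T)).card < B.card by rw [c5, h.1 B hB]; omega)
  rw [Finset.insert_subset_iff] at hsubB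
  have hne : A ≠ B := fun e => h1A (e ▸ hsubB.1)
  have hAB : A ∩ B = insert ptInf T := h.inter_eq_of_subset hA hB hne
    (by rw [Finset.card_insert_of_notMem hIT, hT])
    (Finset.insert_subset hIA fun x hx => (hTm x hx).1) hsubB.2
  have mem := fun x => Finset.ext_iff.1 hAB x
  simp only [Finset.mem_inter, Finset.mem_insert] at mem
  have notB : ∀ x ∈ A, x ≠ ptInf → x ∉ T → x ∉ B := fun x hx h1 h2 h3 => by
    rcases (mem x).1 ⟨hx, h3⟩ with e | e
    exacts [h1 e, h2 e]
  have hiB : i ∉ B := notB i hiA hiI fun h' => (hTm _ h').2.2.2.1 rfl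
  have hjB : j ∉ B := notB j hjA hjI fun h' => (hTm _ h').2.2.2.2 rfl
  have h0B : ptZero ∉ B := notB _ h0A ptZero_ne_ptInf fun h' => (hTm _ h').2.2.1 rfl
  simp only [Finset.mem_insert, not_or] at hk
  have hkA : k ∉ A := fun h' => by
    rcases (mem k).1 ⟨h', hkB⟩ with e | e
    exacts [hk.2.1 e, hk.2.2 e]
  have mA : A ∈ octadsAvoiding 𝒪 ptInf ptZero ptOne :=
    mem_octadsAvoiding.2 ⟨hA, hIA, h0A, h1A⟩
  have mB : B ∈ octadsAvoiding 𝒪 ptInf ptOne ptZero :=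
    mem_octadsAvoiding.2 ⟨hB, hsubB.2 (Finset.mem_insert_self _ _), hsubB.1, h0B⟩
  have e : (2 : ℤ) • (intNu {i} - intNu {j}) =
      (2 : ℤ) • (intNu {i} - intNu {k}) - (2 : ℤ) • (intNu {j} - intNu {k}) := by module
  rw [e]
  exact sub_mem
    (h.two_single_sub_single_mem_of_octads mA mB hT hIT hAB hiA hiB hi0 hkB hkA hk.1)
    (h.two_single_sub_single_mem_of_octads mA mB hT hIT hAB hjA hjB hj0 hkB hkA hk.1)

theorem IsSteinerSystem.two_smul_mem {t : Omega → ℤ} (ht : ∀ i, i ∉ otherPoints → t i = 0)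
    (hs : ∑ i, t i = 0) : (2 : ℤ) • t ∈ rootCombinations 𝒪 := by
  obtain ⟨o, ho⟩ : otherPoints.Nonempty := by
    rw [← Finset.card_pos, card_otherPoints]
    omega
  have hs' : ∑ i ∈ otherPoints, t i = 0 := by
    rw [← hs]
    exact Finset.sum_subset (Finset.subset_univ _) fun i _ hi => ht i hi
  have e : (2 : ℤ) • t = ∑ i ∈ otherPoints, t i • ((2 : ℤ) • (intNu {i} - intNu {o})) := by
    have e1 : ∀ i, t i • ((2 : ℤ) • (intNu {i} - intNu {o})) =
        (2 : ℤ) • (t i • intNu {i}) - t i • ((2 : ℤ) • intNu {o}) := fun i => by module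
    simp only [e1, Finset.sum_sub_distrib, ← Finset.sum_smul, hs', zero_smul, sub_zero,
      ← Finset.smul_sum]
    congr 1
    ext x
    simp only [Finset.sum_apply, Pi.smul_apply, intNu, Finset.mem_singleton, smul_eq_mul,
      mul_ite, mul_one, mul_zero]
    rw [Finset.sum_ite_eq]
    split_ifs with hx
    exacts [rfl, ht x hx]
  rw [e]
  exact sum_mem fun i hi => zsmul_mem (h.two_single_sub_single_mem hi ho) _

/-- Replacing `x` by `x ∆ K` for an octad `K` changes neither the hypothesis on `x` nor the parity of
the sum, and lowers the size of `x` if `K` contains five points of `x`. So `x` may be assumed to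
have at most four points; then its part off `{∞, 0, 1}` is empty by `eq_empty_of_parity_eq`. -/
theorem IsSteinerSystem.even_sum_of_parity_eq {y : Omega → ℤ}
    (hy : ∀ K ∈ 𝒪, Even (∑ i ∈ K, y i)) (hy0 : ∀ i, i ∉ otherPoints → y i = 0)
    (x : Finset Omega)
    (hx : ∀ K ∈ octadsAvoiding 𝒪 ptInf ptZero ptOne,
      ∀ K' ∈ octadsAvoiding 𝒪 ptInf ptZero ptOne,
        (Even (x ∩ K).card ↔ Even (x ∩ K').card)) :
    Even (∑ i ∈ x, y i) := by
  induction hn : x.card using Nat.strong_induction_on generalizing x with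
  | _ n ih =>
    subst hn
    rcases Nat.lt_or_ge 4 x.card with h5 | h4
    · obtain ⟨T, hTx, hT⟩ := Finset.exists_subset_card_eq (show 5 ≤ x.card from h5)
      obtain ⟨K, ⟨hK, hTK⟩, -⟩ := h.2 T hT
      have h1 : 5 ≤ (x ∩ K).card := hT ▸ Finset.card_le_card (Finset.subset_inter hTx hTK)
      have h2 := card_symmDiff_add x K
      have h3 := h.1 K hK
      have par : ∀ K' ∈ 𝒪, (Even (symmDiff x K ∩ K').card ↔ Even (x ∩ K').card) := by
        intro K' hK'
        have h4 := card_symmDiff_inter x K K'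
        obtain ⟨m, hm⟩ := h.even_card_inter hK hK'
        rw [Nat.even_iff, Nat.even_iff]
        omega
      have h6 := ih _ (by omega) (symmDiff x K) (fun K₁ hK₁ K₂ hK₂ => by
        rw [par _ (mem_octadsAvoiding.1 hK₁).1, par _ (mem_octadsAvoiding.1 hK₂).1]
        exact hx K₁ hK₁ K₂ hK₂) rfl
      have h7 : ∑ i ∈ symmDiff x K, y i + 2 * ∑ i ∈ x ∩ K, y i =
          ∑ i ∈ x, y i + ∑ i ∈ K, y i := by
        have e1 : symmDiff x K = (x \ K) ∪ (K \ x) := rfl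
        have a1 := Finset.sum_inter_add_sum_sdiff x K y
        have a2 := Finset.sum_inter_add_sum_sdiff K x y
        rw [Finset.inter_comm] at a2
        rw [e1, Finset.sum_union (disjoint_sdiff_sdiff)]
        omega
      have h8 := hy K hK
      rw [Int.even_iff] at h6 h8 ⊢
      omega
    · have hU : x \ {ptOne, ptInf, ptZero} = ∅ := by
        refine h.eq_empty_of_parity_eq ptZero_ne_ptInf.symm ptOne_ne_ptInf.symm
          ptZero_ne_ptOne Finset.disjoint_sdiff
          ((Finset.card_le_card Finset.sdiff_subset).trans h4) ?_
        have hc : ∀ K ∈ octadsAvoiding 𝒪 ptInf ptZero ptOne, (x ∩ K).card =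
            (K ∩ (x \ {ptOne, ptInf, ptZero})).card + (x ∩ {ptInf, ptZero}).card := by
          intro K hK
          rw [mem_octadsAvoiding] at hK
          rw [← Finset.card_union_of_disjoint]
          · congr 1
            ext i
            simp only [Finset.mem_inter, Finset.mem_union, Finset.mem_sdiff, Finset.mem_insert,
              Finset.mem_singleton]
            by_cases h1 : i = ptInf
            · subst h1
              simp [hK]
            by_cases h2 : i = ptZero
            · subst h2
              simp [hK]
            by_cases h3 : i = ptOne
            · subst h3
              simp [hK, ptZero_ne_ptOne.symm]
            simp [h1, h2, h3, and_comm]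
          · rw [Finset.disjoint_left]
            intro i
            simp only [Finset.mem_inter, Finset.mem_sdiff, Finset.mem_insert,
              Finset.mem_singleton]
            tauto
        intro K hK K' hK'
        have h1 := hx K hK K' hK'
        rw [hc K hK, hc K' hK', Nat.even_add, Nat.even_add] at h1
        tauto
      rw [Finset.sum_eq_zero]
      · exact Even.zero
      · intro i hi
        refine hy0 i fun hi' => ?_
        rw [mem_otherPoints] at hi'
        have : i ∈ x \ {ptOne, ptInf, ptZero} := by simp [hi, hi']
        rw [hU] at this
        exact Finset.notMem_empty i this

/-- If `y` modulo 2 were not in the reduction of `rootCombinations 𝒪`, a linear functional on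
`𝔽₂^Ω`, that is, summation over a set, would separate them. -/
theorem IsSteinerSystem.exists_congr_mod_two {y : Omega → ℤ}
    (hy : ∀ K ∈ 𝒪, Even (∑ i ∈ K, y i)) (hy0 : ∀ i, i ∉ otherPoints → y i = 0) :
    ∃ y' ∈ rootCombinations 𝒪, ∀ i, Even (y i - y' i) := by
  let red : (Omega → ℤ) →+ (Omega → ZMod 2) := (Int.castAddHom (ZMod 2)).compLeft Omega
  let W : Submodule (ZMod 2) (Omega → ZMod 2) :=
    AddSubgroup.toZModSubmodule 2 ((rootCombinations 𝒪).map red)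
  by_cases hW : red y ∈ W
  · obtain ⟨y', hy', e⟩ := hW
    refine ⟨y', hy', fun i => ?_⟩
    have h1 : ((y' i : ℤ) : ZMod 2) = (y i : ZMod 2) := congrFun e i
    rw [← ZMod.intCast_eq_zero_iff_even, Int.cast_sub, h1, sub_self]
  · exfalso
    obtain ⟨f, hf, hfW⟩ := Submodule.exists_le_ker_of_notMem hW
    have hfx : ∀ v : Omega → ℤ, f (red v) =
        ((∑ i ∈ Finset.univ.filter (fun i => f (Pi.single i 1) = 1), v i : ℤ) : ZMod 2) := by
      intro v
      rw [LinearMap.pi_apply_eq_sum_univ, Finset.sum_filter, Int.cast_sum]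
      refine Finset.sum_congr rfl fun i _ => ?_
      have h01 : ∀ c : ZMod 2, c = 0 ∨ c = 1 := by decide
      have e : (fun j => if i = j then (1 : ZMod 2) else 0) = Pi.single i 1 := by
        ext j
        simp [Pi.single_apply, eq_comm]
      rw [e]
      rcases h01 (f (Pi.single i 1)) with h' | h' <;> simp [h', red]
    refine hf ?_
    rw [hfx, ZMod.intCast_eq_zero_iff_even]
    refine h.even_sum_of_parity_eq hy hy0 _ fun K hK K' hK' => ?_
    have h1 : f (red (intNu K - intNu K')) = 0 :=
      hfW (show red _ ∈ W from ⟨_, h.sub_mem_of_even hK hK', rfl⟩)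
    rw [hfx, ZMod.intCast_eq_zero_iff_even] at h1
    simp only [Pi.sub_apply, Finset.sum_sub_distrib, intNu, Finset.sum_boole,
      Finset.filter_mem_eq_inter] at h1
    rw [Int.even_sub, Int.even_coe_nat, Int.even_coe_nat] at h1
    exact h1

theorem IsSteinerSystem.span_leechRootsPerp :
    Submodule.span ℤ (leechRootsPerp 𝒪) = latticeS 𝒪 := by
  refine le_antisymm (span_leechRootsPerp_le 𝒪) fun v hv => ?_
  obtain ⟨A, hA⟩ : (octadsAvoiding 𝒪 ptInf ptZero ptOne).Nonempty := by
    rw [← Finset.card_pos, h.card_octadsAvoiding ptZero_ne_ptInf.symm ptOne_ne_ptInf.symm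
      ptZero_ne_ptOne]
    omega
  obtain ⟨B, hB⟩ : (octadsAvoiding 𝒪 ptInf ptOne ptZero).Nonempty := by
    rw [← Finset.card_pos, h.card_octadsAvoiding ptOne_ne_ptInf.symm ptZero_ne_ptInf.symm
      ptZero_ne_ptOne.symm]
    omega
  obtain ⟨m, z, rfl, -⟩ := h.exists_int_of_mem_latticeS hv
  -- two roots suffice to clear the hyperbolic components and the coordinate at `∞`
  set u := m • evenRoot A + (z ptInf - 2 * m) • (oddRoot B - evenRoot A) with hu
  have hum : u ∈ Submodule.span ℤ (leechRootsPerp 𝒪) := by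
    have mA := Submodule.subset_span (R := ℤ) (h.evenRoot_mem hA)
    have mB := Submodule.subset_span (R := ℤ) (h.oddRoot_mem hB)
    exact add_mem (Submodule.smul_mem _ _ mA) (Submodule.smul_mem _ _ (sub_mem mB mA))
  obtain ⟨m', z', e, hpar, h4, e0, e1, es⟩ :=
    h.exists_int_of_mem_latticeS (sub_mem hv (span_leechRootsPerp_le 𝒪 hum))
  rw [← sub_add_cancel ((m : ℚ), (m : ℚ), fun i => (z i : ℚ)) u]
  refine add_mem ?_ hum
  rw [e]
  rw [mem_octadsAvoiding] at hA hB
  have hm' : m' = 0 := by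
    have := congrArg (fun v : Ambient => v.1) e
    simp [hu, evenRoot, oddRoot] at this
    exact_mod_cast this.symm
  subst hm'
  have hI : z' ptInf = 0 := by
    have := congrArg (fun v : Ambient => v.2.2 ptInf) e
    simp [hu, evenRoot, oddRoot, nu, hA, hB] at this
    have h' : (z' ptInf : ℚ) = 0 := by linarith
    exact_mod_cast h'
  have hall : ∀ i, ∃ y : ℤ, z' i = 2 * y := fun i => by
    obtain ⟨b, hb⟩ := hpar i ptInf
    exact ⟨b, by omega⟩
  choose y hy using hall
  simp only [hy] at hI e0 e1 es h4
  simp only [← Finset.mul_sum] at es h4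
  have hy0 : ∀ {y : Omega → ℤ}, y ptInf = 0 → y ptZero = 0 → y ptOne = 0 →
      ∀ i, i ∉ otherPoints → y i = 0 := by
    intro y hI h0 h1 i hi
    rw [mem_otherPoints] at hi
    by_cases a1 : i = ptInf
    · rw [a1, hI]
    by_cases a2 : i = ptZero
    · rw [a2, h0]
    by_cases a3 : i = ptOne
    · rw [a3, h1]
    exact absurd ⟨a1, a2, a3⟩ hi
  have hyo := hy0 (y := y) (by omega) (by omega) (by omega)
  obtain ⟨y', hy', hev⟩ := h.exists_congr_mod_two
    (fun K hK => by have := h4 K hK; rw [even_iff_two_dvd]; omega) hyo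
  have hyS := span_leechRootsPerp_le 𝒪 (mem_rootCombinations.1 hy').1
  obtain ⟨m₁, z₁, e₁, -, -, f0, f1, fs⟩ := h.exists_int_of_mem_latticeS hyS
  have hm₁ : m₁ = 0 := by
    have := congrArg (fun v : Ambient => v.1) e₁
    simp [doubled_apply] at this
    exact_mod_cast this.symm
  have hz₁ : ∀ i, z₁ i = 2 * y' i := fun i => by
    have := congrArg (fun v : Ambient => v.2.2 i) e₁
    simp only [doubled_apply] at this
    exact_mod_cast this.symm
  have hyI := (mem_rootCombinations.1 hy').2
  simp only [hz₁, hm₁] at f0 f1 fs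
  simp only [← Finset.mul_sum] at fs
  have hyo' := hy0 (y := y') (by omega) (by omega) (by omega)
  choose t ht using hev
  have hyt : y = y' + (2 : ℤ) • t := by
    ext i
    have := ht i
    simp only [Pi.add_apply, Pi.smul_apply, smul_eq_mul]
    omega
  have htm : (2 : ℤ) • t ∈ rootCombinations 𝒪 := by
    refine h.two_smul_mem (fun i hi => ?_) ?_
    · have := ht i
      rw [hyo i hi, hyo' i hi] at this
      omega
    · have : ∑ i, (y i - y' i) = 2 * ∑ i, t i := by
        rw [Finset.mul_sum]
        exact Finset.sum_congr rfl fun i _ => by rw [ht i]; ring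
      rw [Finset.sum_sub_distrib] at this
      omega
  have hfin := (mem_rootCombinations.1 (hyt ▸ add_mem hy' htm)).1
  rw [doubled_apply] at hfin
  simpa [hy] using hfin

end Generation

/-! ### The projection of the Weyl vector -/

/-- The projection of `ρ` to `S ⊗ ℚ`, found by solving for the combination of the four roots of `R`
that has to be added to `ρ` to make it orthogonal to `R`. -/
def projectedWeylVector : Ambient := weylVector + (rootX + rootZ + rootP + rootQ)

theorem projectedWeylVector_eq : projectedWeylVector = (4, 4, (2 : ℚ) • nu Finset.univ +
    (8 : ℚ) • nu {ptInf} + (4 : ℚ) • nu {ptZero} - (4 : ℚ) • nu {ptOne}) := by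
  rw [projectedWeylVector, weylVector, rootX, rootZ, rootP, rootQ]
  ext i
  · norm_num
  · norm_num
  · simp only [Prod.snd_add, Pi.add_apply, Pi.sub_apply, Pi.smul_apply, smul_eq_mul, Pi.zero_apply]
    ring

theorem form_projectedWeylVector {𝒪 : Set (Finset Omega)} {v : Ambient} (hv : v ∈ latticeS 𝒪) :
    form projectedWeylVector v = form weylVector v := by
  obtain ⟨-, h1, h2, h3, h4⟩ := mem_latticeS_iff.1 hv
  rw [projectedWeylVector, form_add_left, form_add_left, form_add_left, form_add_left,
    form_comm rootX, form_comm rootZ, form_comm rootP, form_comm rootQ, h1, h2, h3, h4]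
  ring

section Projection

variable {𝒪 : Set (Finset Omega)} (h : IsSteinerSystem 𝒪)
include h

theorem IsSteinerSystem.sum_nu_octadsAvoiding {a b c : Omega} (hab : a ≠ b) (hac : a ≠ c)
    (hbc : b ≠ c) (i : Omega) : ∑ K ∈ octadsAvoiding 𝒪 a b c, nu K i =
      if i = c then 0 else if i = a ∨ i = b then 56 else 16 := by
  split_ifs with h1 h2
  · subst h1
    exact Finset.sum_eq_zero fun K hK => if_neg (mem_octadsAvoiding.1 hK).2.2.2
  · have : ∀ K ∈ octadsAvoiding 𝒪 a b c, nu K i = 1 := fun K hK => by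
      rw [mem_octadsAvoiding] at hK
      refine if_pos ?_
      rcases h2 with rfl | rfl
      exacts [hK.2.1, hK.2.2.1]
    rw [Finset.sum_congr rfl this, Finset.sum_const, h.card_octadsAvoiding hab hac hbc]
    norm_num
  · have h3 := h.sum_card_inter_avoiding hab hac hbc (U := {i}) (by
      rw [not_or] at h2
      simp [h1, h2.1, h2.2])
    have h4 : ∀ K : Finset Omega, nu K i = ((K ∩ {i}).card : ℚ) := fun K => by
      by_cases hi : i ∈ K <;> simp [nu, hi]
    simp only [h4]
    rw [← Nat.cast_sum, h3]
    norm_num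

/-- The finite set of the Leech roots orthogonal to `R`. -/
noncomputable def perpRoots (𝒪 : Set (Finset Omega)) : Finset Ambient :=
  (octadsAvoiding 𝒪 ptInf ptZero ptOne).image evenRoot ∪
    (octadsAvoiding 𝒪 ptInf ptOne ptZero).image oddRoot

theorem IsSteinerSystem.coe_perpRoots : (perpRoots 𝒪 : Set Ambient) = leechRootsPerp 𝒪 := by
  ext r
  simp only [perpRoots, Finset.coe_union, Finset.coe_image, Set.mem_union, Set.mem_image,
    Finset.mem_coe]
  constructor
  · rintro (⟨K, hK, rfl⟩ | ⟨K, hK, rfl⟩)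
    exacts [h.evenRoot_mem hK, h.oddRoot_mem hK]
  · exact h.eq_evenRoot_or_oddRoot

omit h in
theorem nu_injective : Function.Injective nu := fun K K' e => by
  ext i
  have := congrFun e i
  by_cases h1 : i ∈ K <;> by_cases h2 : i ∈ K' <;> simp_all [nu]

omit h in
theorem sum_perpRoots {M : Type*} [AddCommMonoid M] (f : Ambient → M) :
    ∑ r ∈ perpRoots 𝒪, f r = ∑ K ∈ octadsAvoiding 𝒪 ptInf ptZero ptOne, f (evenRoot K) +
      ∑ K ∈ octadsAvoiding 𝒪 ptInf ptOne ptZero, f (oddRoot K) := by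
  rw [perpRoots, Finset.sum_union, Finset.sum_image, Finset.sum_image]
  · intro K _ K' _ e
    simp only [oddRoot, Prod.mk.injEq, true_and, add_left_inj, sub_right_inj] at e
    exact nu_injective (smul_right_injective _ two_ne_zero e)
  · intro K _ K' _ e
    simp only [evenRoot, Prod.mk.injEq, true_and] at e
    exact nu_injective (smul_right_injective _ two_ne_zero e)
  · rw [Finset.disjoint_left]
    intro r hr hr'
    obtain ⟨K, hK, rfl⟩ := Finset.mem_image.1 hr
    obtain ⟨K', hK', e⟩ := Finset.mem_image.1 hr'
    rw [mem_octadsAvoiding] at hK hK'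
    have := congrArg (fun v : Ambient => v.2.2 ptInf) e
    simp [oddRoot, evenRoot, nu, hK, hK'] at this
    norm_num at this

theorem IsSteinerSystem.card_perpRoots : (perpRoots 𝒪).card = 112 := by
  rw [Finset.card_eq_sum_ones, sum_perpRoots, ← Finset.card_eq_sum_ones, ← Finset.card_eq_sum_ones,
    h.card_octadsAvoiding ptZero_ne_ptInf.symm ptOne_ne_ptInf.symm ptZero_ne_ptOne,
    h.card_octadsAvoiding ptOne_ne_ptInf.symm ptZero_ne_ptInf.symm ptZero_ne_ptOne.symm]

theorem IsSteinerSystem.sum_perpRoots_eq :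
    ∑ r ∈ perpRoots 𝒪, r = (28 : ℚ) • projectedWeylVector := by
  have c0 := h.card_octadsAvoiding ptZero_ne_ptInf.symm ptOne_ne_ptInf.symm ptZero_ne_ptOne
  have c1 := h.card_octadsAvoiding ptOne_ne_ptInf.symm ptZero_ne_ptInf.symm ptZero_ne_ptOne.symm
  rw [sum_perpRoots, projectedWeylVector_eq]
  ext i
  · simp [Prod.fst_sum, evenRoot, oddRoot, c0, c1]
    norm_num
  · simp [Prod.fst_sum, Prod.snd_sum, evenRoot, oddRoot, c0, c1]
    norm_num
  · simp only [Prod.snd_sum, Prod.snd_add, Prod.smul_snd, Pi.add_apply, Finset.sum_apply,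
      evenRoot, oddRoot, Pi.sub_apply, Pi.smul_apply, smul_eq_mul, Finset.sum_add_distrib,
      Finset.sum_sub_distrib, ← Finset.mul_sum, Finset.sum_const, c1,
      h.sum_nu_octadsAvoiding ptZero_ne_ptInf.symm ptOne_ne_ptInf.symm ptZero_ne_ptOne,
      h.sum_nu_octadsAvoiding ptOne_ne_ptInf.symm ptZero_ne_ptInf.symm ptZero_ne_ptOne.symm]
    by_cases hI : i = ptInf
    · subst hI
      simp [nu, ptZero_ne_ptInf.symm, ptOne_ne_ptInf.symm]
      norm_num
    by_cases h0 : i = ptZero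
    · subst h0
      have h01 : (0 : ZMod 23) ≠ 1 := by decide
      simp [nu, h01]
      norm_num
    by_cases h1 : i = ptOne
    · subst h1
      simp [nu, ptZero_ne_ptOne.symm]
      norm_num
    simp [nu, hI, h0, h1]
    norm_num

theorem IsSteinerSystem.projectedWeylVector_mem :
    projectedWeylVector ∈ Submodule.span ℚ (latticeS 𝒪 : Set Ambient) := by
  have h1 : (28 : ℚ) • projectedWeylVector ∈ Submodule.span ℚ (latticeS 𝒪 : Set Ambient) := by
    rw [← h.sum_perpRoots_eq]
    refine sum_mem fun r hr => Submodule.subset_span ?_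
    rw [← Finset.mem_coe, h.coe_perpRoots] at hr
    exact (mem_leechRootsPerp_iff.1 hr).1
  have h2 := Submodule.smul_mem _ (1 / 28 : ℚ) h1
  rw [smul_smul] at h2
  norm_num at h2
  exact h2

/-- The form is nondegenerate on `S ⊗ ℚ`: a vector of the radical is isotropic and orthogonal to
the projected Weyl vector, which has norm 4. By the Cauchy–Schwarz inequality for the negative
definite Leech component it is zero. -/
theorem IsSteinerSystem.eq_zero_of_form_eq_zero {u : Ambient}
    (hu : u ∈ Submodule.span ℚ (latticeS 𝒪 : Set Ambient))
    (horth : ∀ s ∈ latticeS 𝒪, form u s = 0) : u = 0 := by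
  have hspan : ∀ v ∈ Submodule.span ℚ (latticeS 𝒪 : Set Ambient), form v u = 0 := by
    intro v hv
    induction hv using Submodule.span_induction with
    | mem v hv => rw [form_comm]; exact horth v hv
    | zero => exact form_zero_left u
    | add a b _ _ ha hb => rw [form_add_left, ha, hb, add_zero]
    | smul c a _ ha => rw [form_smul_left, ha, mul_zero]
  have hZ : form u rootZ = 0 := by
    clear hspan horth
    induction hu using Submodule.span_induction with
    | mem v hv => exact (mem_latticeS_iff.1 hv).2.2.1
    | zero => exact form_zero_left _
    | add a b _ _ ha hb => rw [form_add_left, ha, hb, add_zero]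
    | smul c a _ ha => rw [form_smul_left, ha, mul_zero]
  have huu := hspan u hu
  have hwu := hspan _ h.projectedWeylVector_mem
  obtain ⟨m, n, l⟩ := u
  rw [form_rootZ] at hZ
  obtain rfl : m = n := sub_eq_zero.1 hZ
  set p : Omega → ℚ := (2 : ℚ) • nu Finset.univ + (8 : ℚ) • nu {ptInf} + (4 : ℚ) • nu {ptZero} -
    (4 : ℚ) • nu {ptOne} with hp
  have hpp : ∑ i, p i ^ 2 = 224 := by
    have : ∑ i, p i ^ 2 = p ⬝ᵥ p := by simp only [dotProduct, pow_two]
    rw [this, hp]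
    simp only [dotProduct_smul, smul_dotProduct, dotProduct_nu, sum_nu,
      smul_eq_mul, dotProduct_add, dotProduct_sub, add_dotProduct, sub_dotProduct,
      Finset.univ_inter, Finset.inter_univ, Finset.card_univ, card_omega, Finset.card_singleton,
      Finset.inter_self, Finset.singleton_inter_of_notMem (Finset.notMem_singleton.2
        ptZero_ne_ptInf), Finset.singleton_inter_of_notMem (Finset.notMem_singleton.2
        ptZero_ne_ptInf.symm), Finset.singleton_inter_of_notMem (Finset.notMem_singleton.2
        ptOne_ne_ptInf), Finset.singleton_inter_of_notMem (Finset.notMem_singleton.2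
        ptOne_ne_ptInf.symm), Finset.singleton_inter_of_notMem (Finset.notMem_singleton.2
        ptZero_ne_ptOne), Finset.singleton_inter_of_notMem (Finset.notMem_singleton.2
        ptZero_ne_ptOne.symm), Finset.card_empty]
    norm_num
  have hpl : ∑ i, p i * l i = 64 * m := by
    rw [projectedWeylVector_eq] at hwu
    simp only [form] at hwu
    linarith
  have hll : ∑ i, l i ^ 2 = 16 * m ^ 2 := by
    simp only [form, ← pow_two] at huu
    linarith
  have hcs := Finset.sum_mul_sq_le_sq_mul_sq Finset.univ p l
  rw [hpl, hpp, hll] at hcs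
  obtain rfl : m = 0 := by nlinarith [sq_nonneg m]
  have hl : ∀ i, l i = 0 := by
    intro i
    rw [zero_pow two_ne_zero, mul_zero] at hll
    exact pow_eq_zero_iff two_ne_zero |>.1
      ((Finset.sum_eq_zero_iff_of_nonneg fun i _ => sq_nonneg (l i)).1 hll i (Finset.mem_univ i))
  ext i
  · rfl
  · rfl
  · exact hl i

theorem IsSteinerSystem.isOrthogonalProjection_iff {v : Ambient} :
    IsOrthogonalProjection (latticeS 𝒪) weylVector v ↔ v = projectedWeylVector := by
  have hw : ∀ s ∈ latticeS 𝒪, form (weylVector - projectedWeylVector) s = 0 := fun s hs => by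
    rw [form_sub_left, form_projectedWeylVector hs, sub_self]
  constructor
  · rintro ⟨hv, horth⟩
    refine sub_eq_zero.1 (h.eq_zero_of_form_eq_zero
      (sub_mem hv h.projectedWeylVector_mem) fun s hs => ?_)
    rw [← sub_sub_sub_cancel_left _ _ weylVector, form_sub_left, hw s hs, horth s hs, sub_self]
  · rintro rfl
    exact ⟨h.projectedWeylVector_mem, hw⟩

omit h in
theorem form_projectedWeylVector_of_mem {r : Ambient} (hr : r ∈ leechRootsPerp 𝒪) :
    form projectedWeylVector r = 1 := by
  rw [mem_leechRootsPerp_iff] at hr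
  rw [form_projectedWeylVector hr.1, form_comm, form_weylVector, hr.2.2]

/-! ### Intersection numbers of the roots -/

theorem IsSteinerSystem.form_eq_zero_or_one {r r' : Ambient} (hr : r ∈ leechRootsPerp 𝒪)
    (hr' : r' ∈ leechRootsPerp 𝒪) (hne : r' ≠ r) : form r r' = 0 ∨ form r r' = 1 := by
  -- distinct octads through `∞` meet in two or four points
  have key : ∀ {K K' : Finset Omega}, K ∈ 𝒪 → K' ∈ 𝒪 → ptInf ∈ K → ptInf ∈ K' → K ≠ K' →
      (K ∩ K').card = 2 ∨ (K ∩ K').card = 4 := by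
    intro K K' hK hK' hI hI' hne
    have h1 := h.card_inter_le_four hK hK' hne
    have h2 : 0 < (K ∩ K').card := Finset.card_pos.2 ⟨_, Finset.mem_inter.2 ⟨hI, hI'⟩⟩
    obtain ⟨m, hm⟩ := h.even_card_inter hK hK'
    omega
  have cross : ∀ {K K' : Finset Omega}, K ∈ octadsAvoiding 𝒪 ptInf ptZero ptOne →
      K' ∈ octadsAvoiding 𝒪 ptInf ptOne ptZero →
      form (evenRoot K) (oddRoot K') = 0 ∨ form (evenRoot K) (oddRoot K') = 1 := by
    intro K K' hK hK'
    rw [mem_octadsAvoiding] at hK hK'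
    rw [form_evenRoot_oddRoot (h.1 K hK.1) hK.2.1]
    rcases key hK.1 hK'.1 hK.2.1 hK'.2.1 (fun e => hK.2.2.2 (e ▸ hK'.2.2.1)) with e | e <;>
      rw [e] <;> norm_num
  rcases h.eq_evenRoot_or_oddRoot hr with ⟨K, hK, rfl⟩ | ⟨K, hK, rfl⟩ <;>
    rcases h.eq_evenRoot_or_oddRoot hr' with ⟨K', hK', rfl⟩ | ⟨K', hK', rfl⟩
  · rw [mem_octadsAvoiding] at hK hK'
    rw [form_evenRoot_evenRoot]
    rcases key hK.1 hK'.1 hK.2.1 hK'.2.1 (fun e => hne (e ▸ rfl)) with e | e <;>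
      rw [e] <;> norm_num
  · exact cross hK hK'
  · rw [form_comm]
    exact cross hK' hK
  · rw [mem_octadsAvoiding] at hK hK'
    rw [form_oddRoot_oddRoot (h.1 K hK.1) (h.1 K' hK'.1) hK.2.1 hK'.2.1]
    rcases key hK.1 hK'.1 hK.2.1 hK'.2.1 (fun e => hne (e ▸ rfl)) with e | e <;>
      rw [e] <;> norm_num

/-- Pairing `r` with the sum of all roots, which is 28 times the projected Weyl vector, gives
`28 = -2 + N` with `N` the number of roots meeting `r`. -/
theorem IsSteinerSystem.ncard_meeting {r : Ambient} (hr : r ∈ leechRootsPerp 𝒪) :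
    {r' ∈ leechRootsPerp 𝒪 | r' ≠ r ∧ form r r' ≠ 0}.ncard = 30 := by
  have hset : {r' ∈ leechRootsPerp 𝒪 | r' ≠ r ∧ form r r' ≠ 0} =
      (((perpRoots 𝒪).erase r).filter fun r' => form r r' ≠ 0 : Finset Ambient) := by
    ext r'
    simp only [Finset.coe_filter, Finset.mem_erase, Set.mem_ofPred_eq, ← h.coe_perpRoots,
      Finset.mem_coe]
    tauto
  have hrm : r ∈ perpRoots 𝒪 := by rwa [← Finset.mem_coe, h.coe_perpRoots]
  have hform : ∀ F : Finset Ambient, form (∑ r' ∈ F, r') r = ∑ r' ∈ F, form r' r := by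
    intro F
    induction F using Finset.induction_on with
    | empty => simp [form_zero_left]
    | insert a s ha ih => rw [Finset.sum_insert ha, Finset.sum_insert ha, form_add_left, ih]
  have hsum := hform (perpRoots 𝒪)
  rw [h.sum_perpRoots_eq, form_smul_left, form_projectedWeylVector_of_mem hr,
    ← Finset.add_sum_erase _ _ hrm, (mem_leechRootsPerp_iff.1 hr).2.1] at hsum
  have hind : ∑ r' ∈ (perpRoots 𝒪).erase r, form r' r =
      ∑ r' ∈ (perpRoots 𝒪).erase r, if form r r' ≠ 0 then (1 : ℚ) else 0 := by
    refine Finset.sum_congr rfl fun r' hr' => ?_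
    rw [Finset.mem_erase, ← Finset.mem_coe, h.coe_perpRoots] at hr'
    rw [form_comm]
    rcases h.form_eq_zero_or_one hr hr'.2 hr'.1 with e | e <;> simp [e]
  rw [hind, Finset.sum_boole] at hsum
  rw [hset, Set.ncard_coe_finset]
  have : ((((perpRoots 𝒪).erase r).filter fun r' => form r r' ≠ 0).card : ℚ) = 30 := by linarith
  exact_mod_cast this

end Projection

theorem mainTheorem6 (𝒪 : Set (Finset Omega)) (h𝒪 : IsSteinerSystem 𝒪) :
    (leechRootsPerp 𝒪).ncard = 112 ∧
    (∀ r ∈ leechRootsPerp 𝒪,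
      {r' ∈ leechRootsPerp 𝒪 | r' ≠ r ∧ form r r' ≠ 0}.ncard = 30 ∧
      ∀ r' ∈ leechRootsPerp 𝒪, r' ≠ r → form r r' = 0 ∨ form r r' = 1) ∧
    Submodule.span ℤ (leechRootsPerp 𝒪) = latticeS 𝒪 ∧
    ∃ w : Ambient,
      (∀ v : Ambient, IsOrthogonalProjection (latticeS 𝒪) weylVector v ↔ v = w) ∧
      (∀ r ∈ leechRootsPerp 𝒪, form w r = 1) ∧
      w = (1 / 28 : ℚ) • ∑ᶠ r ∈ leechRootsPerp 𝒪, r := by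
  refine ⟨?_, fun r hr => ⟨h𝒪.ncard_meeting hr, fun r' hr' => h𝒪.form_eq_zero_or_one hr hr'⟩,
    h𝒪.span_leechRootsPerp, projectedWeylVector, fun v => h𝒪.isOrthogonalProjection_iff,
    fun r hr => form_projectedWeylVector_of_mem hr, ?_⟩
  · rw [← h𝒪.coe_perpRoots, Set.ncard_coe_finset, h𝒪.card_perpRoots]
  · rw [← h𝒪.coe_perpRoots, finsum_mem_coe_finset, h𝒪.sum_perpRoots_eq, smul_smul]
    norm_num
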